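/- For every $n$ there is a constant $C>0$, depending only on the space dimension $n$, such that the following holds. Let $\Omega\subset\mathbb R^n$ be a convex domain, let $M\ge 1$ be an integer, put $N=2M$, and let $u$ be a real-valued function that is harmonic in $\Omega$ and satisfies $$ c_u=\sum_{|\beta|=2M}\|\partial^\beta u\|_{L_\infty(\Omega)}\prod_{\beta_j>0}\sqrt{\frac{2}{(\beta_j-1)!}}<\infty . $$ Then for every $\varepsilon>0$ and every subdomain (indeed every subset) $\Omega'\subset\Omega$ with $\operatorname{dist}(\Omega',\partial\Omega)>0$ (no restriction if $\Omega=\mathbb R^n$) there exist $\mathcal D>0$ and $h_0>0$ such that for every $h$ with $0<h\le h_0$ and every $x\in\Omega'$ the series defining the quasi-interpolant $$ Mu(x)=(\pi\mathcal D)^{-n/2}\sum_{m\in\mathbb Z^n,\; hm\in\Omega}u(hm)\,e^{-|x-hm|^2/(h^2\mathcal D)} $$ converges absolutely and $$ |u(x)-Mu(x)|\le C\,(h\sqrt{\mathcal D})^{N}c_u+\varepsilon\sum_{|\beta|=0}^{N-1}(h\sqrt{\mathcal D})^{|\beta|}\,|\partial^\beta u(x)| . $$ -/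

import Mathlib

open scoped ENNReal Nat
open MeasureTheory

noncomputable section

namespace HarmonicQI

/-- The partial derivative `∂ᵢ f` of a function on `ℝⁿ`. -/
def pderiv {n : ℕ} (i : Fin n) (f : EuclideanSpace ℝ (Fin n) → ℝ) :
    EuclideanSpace ℝ (Fin n) → ℝ :=
  fun x => lineDeriv ℝ f x (EuclideanSpace.single i 1)

/-- The derivative `∂^β f = ∂₁^{β₁} ⋯ ∂ₙ^{βₙ} f` for a multi-index `β`. -/
def mderiv {n : ℕ} (β : Fin n → ℕ) (f : EuclideanSpace ℝ (Fin n) → ℝ) :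
    EuclideanSpace ℝ (Fin n) → ℝ :=
  (List.finRange n).foldr (fun i g => (pderiv i)^[β i] g) f

/-- The finite set of multi-indices `β ∈ ℕⁿ` with `|β| = β₁ + ⋯ + βₙ = k`. -/
def multiIdx (n k : ℕ) : Finset (Fin n → ℕ) := Finset.piAntidiag Finset.univ k

/-- The weighted sum of the sup norms of the derivatives of order `N`,
`c_u = ∑_{|β| = N} ‖∂^β u‖_{L_∞(Ω)} ∏_{β_j > 0} √(2 / (β_j - 1)!)`,
as an extended nonnegative number. -/
def cConst {n : ℕ} (N : ℕ) (Ω : Set (EuclideanSpace ℝ (Fin n)))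
    (u : EuclideanSpace ℝ (Fin n) → ℝ) : ℝ≥0∞ :=
  ∑ β ∈ multiIdx n N, eLpNorm (mderiv β u) ∞ (volume.restrict Ω) *
    ENNReal.ofReal (∏ j with 0 < β j, √(2 / ((β j - 1)! : ℝ)))

/-- The grid point `h m`, where `m ∈ ℤⁿ`. -/
def gridPt {n : ℕ} (h : ℝ) (m : Fin n → ℤ) : EuclideanSpace ℝ (Fin n) :=
  WithLp.toLp 2 fun i => h * (m i : ℝ)

/-- The summand `u(hm) exp(-|x - hm|² / (h² D))` of the quasi-interpolant. -/
def qiTerm {n : ℕ} (u : EuclideanSpace ℝ (Fin n) → ℝ) (D h : ℝ)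
    (x : EuclideanSpace ℝ (Fin n)) (m : Fin n → ℤ) : ℝ :=
  u (gridPt h m) * Real.exp (-‖x - gridPt h m‖ ^ 2 / (h ^ 2 * D))

/-- The truncated Gaussian quasi-interpolant
`M u(x) = (π D)^{-n/2} ∑_{hm ∈ Ω} u(hm) exp(-|x - hm|² / (h² D))`. -/
def quasiInterp {n : ℕ} (Ω : Set (EuclideanSpace ℝ (Fin n)))
    (u : EuclideanSpace ℝ (Fin n) → ℝ) (D h : ℝ) (x : EuclideanSpace ℝ (Fin n)) : ℝ :=
  (Real.pi * D) ^ (-(n : ℝ) / 2) *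
    ∑' m : {m : Fin n → ℤ // gridPt h m ∈ Ω}, qiTerm u D h x m

end HarmonicQI

end

/-!
The function `u` is smooth by Weyl's lemma (`contDiffOn_of_harmonicOnNhd`), so on the convex set `Ω`
each value `u (hm)` may be expanded by Taylor's formula at `x` up to order `N = 2M`
(`abs_sub_multivariate_taylor_le`). With `H = h √D` and `yₘ = (hm - x) / H`, the quasi-interpolant
is a sum over the nodes of `Ω` with the product weights `wₘ = ∏ⱼ (πD)^{-1/2} exp(-yₘⱼ²)`, and the
expansion turns it into
`∑_{|α| < N} ∂^α u(x) / α! · H^{|α|} · ∑ₘ wₘ yₘ^α` plus a remainder.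

* The sums `∑ wₘ yₘ^α` over the whole lattice are products of one-dimensional Riemann sums of mesh
  `1 / √D`. They converge to the moments of the Gaussian `π^{-n/2} exp(-|y|²)` as `D → ∞`, uniformly
  in `x / h` (`tendsto_discreteMoment`, `eventually_multi_moment`). The nodes outside `Ω` are at
  distance at least `δ` from `x`, and for fixed `D` they contribute `O(h²)`
  (`eventually_abs_tail_le`). So for `D` large and then `h` small all moments are within `ε` of the
  Gaussian ones, which accounts for the sum with the factor `ε`.
* With the exact Gaussian moments, the terms with `|α| = k` cancel for odd `k`, and for even `k` they
  add up to a multiple of `Δ^{k/2} u (x)`, which is zero for `k > 0`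
  (`sum_moment_mderiv_eq_zero`, `sum_taylor_gaussMoment`); what remains is `u x`.
* The remainder is at most `H^N ∑_{|β| = N} ‖∂^β u‖ / β! · ∑ₘ wₘ |yₘ^β|`, and for large `D` the
  absolute moments are bounded by `2^n β! ∏_{β_j > 0} √(2 / (β_j - 1)!)`
  (`eventually_absMoment_le`, `prod_momentBound_le`). This gives `C = 2^n`, independent of `M`.
-/

noncomputable section

namespace HarmonicQI

/-! ### Multivariate Taylor formula and powers of the Laplacian -/

section Operators

open Filter Topology Set
open scoped ContDiff

theorem pderiv_eq_fderiv {n : ℕ} (i : Fin n) {f : EuclideanSpace ℝ (Fin n) → ℝ}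
    {x : EuclideanSpace ℝ (Fin n)} (hf : DifferentiableAt ℝ f x) :
    pderiv i f x = fderiv ℝ f x (EuclideanSpace.single i 1) :=
  hf.lineDeriv_eq_fderiv

theorem eqOn_pderiv {n : ℕ} {Ω : Set (EuclideanSpace ℝ (Fin n))} (hΩ : IsOpen Ω) (i : Fin n)
    {f g : EuclideanSpace ℝ (Fin n) → ℝ} (h : EqOn f g Ω) : EqOn (pderiv i f) (pderiv i g) Ω := by
  intro x hx
  exact Filter.EventuallyEq.lineDeriv_eq (h.eventuallyEq_of_mem (hΩ.mem_nhds hx))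

/-- The functions on `ℝⁿ` that are smooth on the open set `Ω` and vanish outside `Ω`: a model of
`C^∞(Ω)` on which the partial derivatives are linear endomorphisms. -/
def smoothOn {n : ℕ} (Ω : TopologicalSpace.Opens (EuclideanSpace ℝ (Fin n))) :
    Submodule ℝ (EuclideanSpace ℝ (Fin n) → ℝ) where
  carrier := {f | ContDiffOn ℝ ∞ f Ω ∧ ∀ x ∉ Ω, f x = 0}
  add_mem' := fun {f g} hf hg => ⟨hf.1.add hg.1, fun x hx => by simp [hf.2 x hx, hg.2 x hx]⟩
  zero_mem' := ⟨contDiffOn_const, fun _ _ => rfl⟩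
  smul_mem' := fun c f hf => ⟨contDiffOn_const.smul hf.1, fun x hx => by simp [hf.2 x hx]⟩

variable {n : ℕ} {Ω : TopologicalSpace.Opens (EuclideanSpace ℝ (Fin n))}

theorem smoothOn.contDiffAt (f : smoothOn Ω) {x : EuclideanSpace ℝ (Fin n)} (hx : x ∈ Ω) :
    ContDiffAt ℝ ∞ (f : EuclideanSpace ℝ (Fin n) → ℝ) x :=
  f.2.1.contDiffAt (Ω.2.mem_nhds hx)

theorem smoothOn.differentiableAt (f : smoothOn Ω) {x : EuclideanSpace ℝ (Fin n)} (hx : x ∈ Ω) :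
    DifferentiableAt ℝ (f : EuclideanSpace ℝ (Fin n) → ℝ) x :=
  (smoothOn.contDiffAt f hx).differentiableAt (by simp)

theorem smoothOn.pderiv_eqOn (f : smoothOn Ω) (i : Fin n) :
    EqOn (pderiv i (f : EuclideanSpace ℝ (Fin n) → ℝ))
      (fun x => fderiv ℝ (f : EuclideanSpace ℝ (Fin n) → ℝ) x (EuclideanSpace.single i 1)) Ω :=
  fun _ hx => pderiv_eq_fderiv i (smoothOn.differentiableAt f hx)

/-- The partial derivative `∂ᵢ` as an endomorphism of `smoothOn Ω`. -/
def partialOp (Ω : TopologicalSpace.Opens (EuclideanSpace ℝ (Fin n))) (i : Fin n) :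
    Module.End ℝ (smoothOn Ω) where
  toFun f := ⟨(Ω : Set (EuclideanSpace ℝ (Fin n))).indicator (pderiv i f), by
    constructor
    · have h1 : ContDiffOn ℝ ∞ (fun x => fderiv ℝ (f : EuclideanSpace ℝ (Fin n) → ℝ) x
          (EuclideanSpace.single i 1)) Ω :=
        (f.2.1.fderiv_of_isOpen Ω.2 (m := ∞) (by simp)).clm_apply contDiffOn_const
      refine h1.congr fun x hx => ?_
      rw [indicator_of_mem hx, smoothOn.pderiv_eqOn f i hx]
    · intro x hx
      exact indicator_of_notMem hx _⟩
  map_add' f g := by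
    ext x
    by_cases hx : x ∈ (Ω : Set (EuclideanSpace ℝ (Fin n)))
    · have h3 := smoothOn.pderiv_eqOn (f + g) i hx
      simp only [Submodule.coe_add] at h3 ⊢
      rw [Pi.add_apply, indicator_of_mem hx, indicator_of_mem hx, indicator_of_mem hx, h3,
        smoothOn.pderiv_eqOn f i hx, smoothOn.pderiv_eqOn g i hx,
        fderiv_add (smoothOn.differentiableAt f hx) (smoothOn.differentiableAt g hx)]
      rfl
    · simp [hx]
  map_smul' c f := by
    ext x
    by_cases hx : x ∈ (Ω : Set (EuclideanSpace ℝ (Fin n)))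
    · have h3 := smoothOn.pderiv_eqOn (c • f) i hx
      simp only [Submodule.coe_smul, RingHom.id_apply] at h3 ⊢
      rw [Pi.smul_apply, indicator_of_mem hx, indicator_of_mem hx, h3,
        smoothOn.pderiv_eqOn f i hx, fderiv_const_smul (smoothOn.differentiableAt f hx)]
      rfl
    · simp [hx]

theorem partialOp_apply (i : Fin n) (f : smoothOn Ω) {x : EuclideanSpace ℝ (Fin n)} (hx : x ∈ Ω) :
    (partialOp Ω i f : EuclideanSpace ℝ (Fin n) → ℝ) x = pderiv i f x :=
  indicator_of_mem (s := (Ω : Set (EuclideanSpace ℝ (Fin n)))) hx _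

theorem partialOp_eqOn (i : Fin n) (f : smoothOn Ω) :
    EqOn (partialOp Ω i f : EuclideanSpace ℝ (Fin n) → ℝ)
      (fun x => fderiv ℝ (f : EuclideanSpace ℝ (Fin n) → ℝ) x (EuclideanSpace.single i 1)) Ω :=
  fun _ hx => (partialOp_apply i f hx).trans (smoothOn.pderiv_eqOn f i hx)

theorem partialOp_partialOp_apply (i j : Fin n) (f : smoothOn Ω) {x : EuclideanSpace ℝ (Fin n)}
    (hx : x ∈ Ω) :
    (partialOp Ω i (partialOp Ω j f) : EuclideanSpace ℝ (Fin n) → ℝ) x =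
      fderiv ℝ (fderiv ℝ (f : EuclideanSpace ℝ (Fin n) → ℝ)) x
        (EuclideanSpace.single i 1) (EuclideanSpace.single j 1) := by
  rw [partialOp_eqOn i _ hx]
  have h1 := ((partialOp_eqOn j f).eventuallyEq_of_mem (Ω.2.mem_nhds hx)).fderiv_eq (𝕜 := ℝ)
  have h2 : DifferentiableAt ℝ (fderiv ℝ (f : EuclideanSpace ℝ (Fin n) → ℝ)) x :=
    ((smoothOn.contDiffAt f hx).fderiv_right (m := 1) (by decide)).differentiableAt (by simp)
  simp only [h1]
  rw [fderiv_clm_apply h2 (differentiableAt_const _)]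
  simp

/-- Symmetry of the second derivative. -/
theorem partialOp_commute (i j : Fin n) : Commute (partialOp Ω i) (partialOp Ω j) := by
  ext f x
  by_cases hx : x ∈ Ω
  · have h := (smoothOn.contDiffAt f hx).isSymmSndFDerivAt
      (by rw [minSmoothness_of_isRCLikeNormedField]; exact WithTop.coe_le_coe.2 le_top)
    simp only [Module.End.mul_apply]
    rw [partialOp_partialOp_apply i j f hx, partialOp_partialOp_apply j i f hx]
    exact h _ _
  · rw [(partialOp Ω i * partialOp Ω j) f |>.2.2 x hx,
      (partialOp Ω j * partialOp Ω i) f |>.2.2 x hx]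

/-- The monomial `A₁^{β₁} ⋯ Aₙ^{βₙ}`, the factors being multiplied in this order. -/
def orderedMonomial {R : Type*} [Monoid R] (A : Fin n → R) (β : Fin n → ℕ) : R :=
  ((List.finRange n).map fun i => A i ^ β i).prod

/-- The multinomial theorem for commuting elements of a noncommutative algebra, such as the partial
derivatives. -/
theorem sum_pow_eq_sum_orderedMonomial {R : Type*} [Semiring R] [Algebra ℝ R] (A : Fin n → R)
    (hA : ∀ i j, Commute (A i) (A j)) (k : ℕ) :
    (∑ i, A i) ^ k =
      ∑ β ∈ multiIdx n k, (Nat.multinomial Finset.univ β : ℝ) • orderedMonomial A β := by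
  rw [Finset.sum_pow_eq_sum_piAntidiag_of_commute _ _ (fun i _ j _ _ => hA i j)]
  refine Finset.sum_congr rfl fun β _ => ?_
  rw [Nat.cast_smul_eq_nsmul, nsmul_eq_mul]
  congr 1
  have : (List.finRange n).toFinset = Finset.univ := by ext; simp
  rw [orderedMonomial, ← Finset.noncommProd_toFinset (List.finRange n) (fun i => A i ^ β i)
    (fun i _ j _ _ => (hA i j).pow_pow _ _) (List.nodup_finRange n)]
  congr 1
  exact this.symm

theorem orderedMonomial_smul {R : Type*} [Semiring R] [Algebra ℝ R] (c : Fin n → ℝ) (A : Fin n → R)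
    (β : Fin n → ℕ) :
    orderedMonomial (fun i => c i • A i) β = (∏ i, c i ^ β i) • orderedMonomial A β := by
  have h : ∀ l : List (Fin n), (l.map fun i => (c i • A i) ^ β i).prod =
      (l.map fun i => c i ^ β i).prod • (l.map fun i => A i ^ β i).prod := by
    intro l
    induction l with
    | nil => simp
    | cons i l ih =>
      rw [List.map_cons, List.prod_cons, ih, smul_pow, smul_mul_smul_comm]
      simp only [List.map_cons, List.prod_cons]
  rw [orderedMonomial, h, orderedMonomial]
  rw [← List.ofFn_eq_map, List.prod_ofFn]

theorem orderedMonomial_pow {R : Type*} [Monoid R] (A : Fin n → R) (p : ℕ) (β : Fin n → ℕ) :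
    orderedMonomial (fun i => A i ^ p) β = orderedMonomial A (fun i => p * β i) := by
  simp [orderedMonomial, pow_mul]

/-- On `Ω`, the derivative `∂^β` is the monomial in the operators `partialOp Ω i`. -/
theorem mderiv_eqOn_orderedMonomial (β : Fin n → ℕ) (f : EuclideanSpace ℝ (Fin n) → ℝ)
    (g : smoothOn Ω) (hfg : EqOn f g Ω) :
    EqOn (mderiv β f) (orderedMonomial (partialOp Ω) β g : smoothOn Ω) Ω := by
  have hone : ∀ (i : Fin n) (k : ℕ) (f : EuclideanSpace ℝ (Fin n) → ℝ) (g : smoothOn Ω),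
      EqOn f g Ω → EqOn ((pderiv i)^[k] f) ((partialOp Ω i ^ k) g : smoothOn Ω) Ω := by
    intro i k
    induction k with
    | zero => intro f g h; simpa using h
    | succ k ih =>
      intro f g h
      rw [Function.iterate_succ_apply', pow_succ']
      intro x hx
      rw [eqOn_pderiv Ω.2 i (ih f g h) hx, Module.End.mul_apply, partialOp_apply i _ hx]
  have h : ∀ l : List (Fin n), EqOn (l.foldr (fun i g => (pderiv i)^[β i] g) f)
      ((l.map fun i => partialOp Ω i ^ β i).prod g : smoothOn Ω) Ω := by
    intro l
    induction l with
    | nil => simpa using hfg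
    | cons i l ih =>
      simp only [List.foldr_cons, List.map_cons, List.prod_cons, Module.End.mul_apply]
      exact hone i _ _ _ ih
  exact h _

/-- Along a line in the direction `v`, differentiation is the operator `∑ᵢ vᵢ ∂ᵢ`. -/
theorem smoothOn.hasDerivAt_line (f : smoothOn Ω) (x v : EuclideanSpace ℝ (Fin n)) {t : ℝ}
    (ht : x + t • v ∈ Ω) :
    HasDerivAt (fun t : ℝ => (f : EuclideanSpace ℝ (Fin n) → ℝ) (x + t • v))
      (((∑ i, v i • partialOp Ω i) f : smoothOn Ω).1 (x + t • v)) t := by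
  have h1 := (smoothOn.differentiableAt f ht).hasFDerivAt
  have h2 : HasDerivAt (fun t : ℝ => x + t • v) v t := by
    simpa using ((hasDerivAt_id t).smul_const v).const_add x
  convert! h1.comp_hasDerivAt t h2 using 1
  have hv : v = ∑ i, v i • EuclideanSpace.single i (1 : ℝ) := by
    ext j; simp [Pi.single_apply]
  have hA : ∀ A : EuclideanSpace ℝ (Fin n) →L[ℝ] ℝ,
      A v = ∑ i, v i • A (EuclideanSpace.single i 1) := fun A => by
    conv_lhs => rw [hv, map_sum]
    simp
  rw [hA]
  simp only [LinearMap.sum_apply, Submodule.coe_sum, Finset.sum_apply, LinearMap.smul_apply,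
    Submodule.coe_smul, Pi.smul_apply]
  exact Finset.sum_congr rfl fun i _ => by rw [partialOp_eqOn i f ht]

/-- Taylor's inequality for a chain of successive derivatives on `[0, 1]`. -/
theorem abs_sub_taylor_le {N : ℕ} {B : ℝ} (G : ℕ → ℝ → ℝ)
    (hG : ∀ k < N, ∀ t ∈ Icc (0 : ℝ) 1, HasDerivAt (G k) (G (k + 1) t) t)
    (hB : ∀ t ∈ Icc (0 : ℝ) 1, |G N t| ≤ B) {t : ℝ} (ht : t ∈ Icc (0 : ℝ) 1) :
    |G 0 t - ∑ k ∈ Finset.range N, G k 0 * t ^ k / k !| ≤ B * t ^ N / N ! := by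
  induction N generalizing G t with
  | zero => simpa using hB t ht
  | succ N ih =>
    have h1 := fun (s : ℝ) (hs : s ∈ Icc (0 : ℝ) 1) => ih (fun k => G (k + 1))
      (fun k hk s hs => hG (k + 1) (by lia) s hs) hB (t := s) hs
    have hp : ∀ (k : ℕ) (s : ℝ), HasDerivAt (fun s : ℝ => s ^ (k + 1) / ((k + 1)! : ℝ))
        (s ^ k / k !) s := by
      intro k s
      convert! (hasDerivAt_pow (k + 1) s).div_const ((k + 1)! : ℝ) using 1
      rw [Nat.factorial_succ]
      have : (k ! : ℝ) ≠ 0 := by positivity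
      push_cast
      field_simp
    have hd : ∀ s ∈ Icc (0 : ℝ) 1,
        HasDerivAt (fun s => G 0 s - ∑ k ∈ Finset.range (N + 1), G k 0 * s ^ k / k !)
          (G 1 s - ∑ k ∈ Finset.range N, G (k + 1) 0 * s ^ k / k !) s := by
      intro s hs
      simp only [Finset.sum_range_succ']
      refine (hG 0 (by lia) s hs).sub ?_
      simp only [pow_zero]
      refine HasDerivAt.add_const _ ?_
      refine HasDerivAt.fun_sum fun k _ => ?_
      simpa [mul_div_assoc] using (hp k s).const_mul (G (k + 1) 0)
    have := image_norm_le_of_norm_deriv_right_le_deriv_boundary (a := (0 : ℝ)) (b := 1)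
      (f := fun s => G 0 s - ∑ k ∈ Finset.range (N + 1), G k 0 * s ^ k / k !)
      (f' := fun s => G 1 s - ∑ k ∈ Finset.range N, G (k + 1) 0 * s ^ k / k !)
      (B := fun s => B * (s ^ (N + 1) / ((N + 1)! : ℝ))) (B' := fun s => B * (s ^ N / N !))
      (fun s hs => (hd s hs).continuousAt.continuousWithinAt)
      (fun s hs => (hd s (Ico_subset_Icc_self hs)).hasDerivWithinAt)
      (by simp [Finset.sum_range_succ'])
      (fun s => (hp N s).const_mul B)
      (fun s hs => by simpa [mul_div_assoc] using h1 s (Ico_subset_Icc_self hs)) ht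
    simpa [mul_div_assoc] using this

theorem multinomial_div_factorial {k : ℕ} {β : Fin n → ℕ} (hβ : β ∈ multiIdx n k) :
    (Nat.multinomial Finset.univ β : ℝ) / k ! = 1 / ∏ i, ((β i)! : ℝ) := by
  have h := Nat.multinomial_spec Finset.univ β
  rw [(Finset.mem_piAntidiag.1 hβ).1] at h
  have h' : (∏ i, ((β i)! : ℝ)) * Nat.multinomial Finset.univ β = k ! := by exact_mod_cast h
  have h1 : (∏ i, ((β i)! : ℝ)) ≠ 0 := Finset.prod_ne_zero_iff.2 fun i _ => by positivity
  have h2 : (k ! : ℝ) ≠ 0 := by positivity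
  field_simp
  linarith

/-- The Taylor coefficient of order `k` along `v`, expanded by the multinomial theorem. -/
theorem directional_pow_apply (f : smoothOn Ω) (v z : EuclideanSpace ℝ (Fin n)) (k : ℕ) :
    ((((∑ i, v i • partialOp Ω i) ^ k) f : smoothOn Ω) : EuclideanSpace ℝ (Fin n) → ℝ) z / k ! =
      ∑ β ∈ multiIdx n k, (orderedMonomial (partialOp Ω) β f : smoothOn Ω).1 z /
        (∏ i, ((β i)! : ℝ)) * ∏ i, v i ^ β i := by
  rw [sum_pow_eq_sum_orderedMonomial _
    fun i j => ((partialOp_commute i j).smul_left _).smul_right _]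
  simp only [orderedMonomial_smul]
  simp only [LinearMap.sum_apply, Submodule.coe_sum, Finset.sum_apply, Finset.sum_div]
  refine Finset.sum_congr rfl fun β hβ => ?_
  have h := multinomial_div_factorial hβ
  rw [div_eq_mul_one_div _ (∏ i, ((β i)! : ℝ)), ← h]
  simp only [LinearMap.smul_apply, Submodule.coe_smul, Pi.smul_apply, smul_eq_mul]
  ring

/-- A smooth function on `Ω`, extended by zero. -/
def smoothOn.mk {u : EuclideanSpace ℝ (Fin n) → ℝ} (hu : ContDiffOn ℝ ∞ u Ω) : smoothOn Ω :=
  ⟨(Ω : Set (EuclideanSpace ℝ (Fin n))).indicator u,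
    hu.congr fun _ hx => indicator_of_mem hx _, fun _ hx => indicator_of_notMem hx _⟩

theorem smoothOn.mk_eqOn {u : EuclideanSpace ℝ (Fin n) → ℝ} (hu : ContDiffOn ℝ ∞ u Ω) :
    EqOn u (smoothOn.mk hu : smoothOn Ω) Ω :=
  fun _ hx => (indicator_of_mem hx u).symm

theorem continuousOn_mderiv {u : EuclideanSpace ℝ (Fin n) → ℝ} (hu : ContDiffOn ℝ ∞ u Ω)
    (β : Fin n → ℕ) : ContinuousOn (mderiv β u) Ω :=
  (orderedMonomial (partialOp Ω) β (smoothOn.mk hu)).2.1.continuousOn.congr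
    (mderiv_eqOn_orderedMonomial β u _ (smoothOn.mk_eqOn hu))

/-- The multivariate Taylor formula on a convex open set, with the remainder estimated termwise by
the sup norms of the derivatives of order `N`. -/
theorem abs_sub_multivariate_taylor_le (hΩ : Convex ℝ (Ω : Set (EuclideanSpace ℝ (Fin n))))
    {u : EuclideanSpace ℝ (Fin n) → ℝ} (hu : ContDiffOn ℝ ∞ u Ω) {N : ℕ} {B : (Fin n → ℕ) → ℝ}
    (hB : ∀ β ∈ multiIdx n N, ∀ z ∈ Ω, |mderiv β u z| ≤ B β)
    {x y : EuclideanSpace ℝ (Fin n)} (hx : x ∈ Ω) (hy : y ∈ Ω) :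
    |u y - ∑ k ∈ Finset.range N, ∑ α ∈ multiIdx n k,
        mderiv α u x / (∏ i, ((α i)! : ℝ)) * ∏ i, (y i - x i) ^ α i| ≤
      ∑ β ∈ multiIdx n N, B β / (∏ i, ((β i)! : ℝ)) * ∏ i, |y i - x i| ^ β i := by
  set f := smoothOn.mk hu
  have hf := smoothOn.mk_eqOn hu
  have hm := fun β => mderiv_eqOn_orderedMonomial β u f hf
  set v := y - x with hv
  have hseg : ∀ t ∈ Icc (0 : ℝ) 1, x + t • v ∈ Ω := fun t ht => by
    have := hΩ.add_smul_sub_mem hx hy ht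
    exact this
  set D := ∑ i, v i • partialOp Ω i with hD
  have key := abs_sub_taylor_le (N := N)
    (B := N ! * ∑ β ∈ multiIdx n N, B β / (∏ i, ((β i)! : ℝ)) * ∏ i, |v i| ^ β i)
    (fun k t => ((D ^ k) f : smoothOn Ω).1 (x + t • v))
    (fun k _ t ht => by
      simp only [pow_succ', Module.End.mul_apply]
      exact smoothOn.hasDerivAt_line _ x v (hseg t ht))
    (fun t ht => by
      have hN : (0 : ℝ) < N ! := by positivity
      have habs : ∀ r : ℝ, |r| / N ! = |r / N !| := fun r => by rw [abs_div, abs_of_pos hN]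
      rw [← div_le_iff₀' hN, habs, directional_pow_apply f v _ N]
      refine (Finset.abs_sum_le_sum_abs _ _).trans (Finset.sum_le_sum fun β hβ => ?_)
      have hp : (0 : ℝ) < ∏ i, ((β i)! : ℝ) := Finset.prod_pos fun i _ => by positivity
      rw [abs_mul, abs_div, abs_of_pos hp, Finset.abs_prod]
      simp only [abs_pow]
      gcongr
      rw [← hm β (hseg t ht)]
      exact hB β hβ _ (hseg t ht))
    (t := 1) (by simp)
  have hN : (N ! : ℝ) ≠ 0 := by positivity
  simp only [one_pow, mul_one, one_smul, zero_smul, add_zero, pow_zero, Module.End.one_apply] at key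
  rw [mul_div_assoc, mul_div_cancel₀ _ hN] at key
  simp only [hD, directional_pow_apply] at key
  have hxy : x + v = y := by simp [hv]
  rw [hxy, ← hf hy] at key
  simp only [← hm _ hx] at key
  simpa [hv] using key

/-- In the operator model `∑ᵢ ∂ᵢ²` is the Laplacian. -/
theorem sum_partialOp_sq_eq_zero {u : EuclideanSpace ℝ (Fin n) → ℝ}
    (hu : ContDiffOn ℝ ∞ u Ω) (hΔ : ∀ x ∈ Ω, Laplacian.laplacian u x = 0) :
    (∑ i, partialOp Ω i ^ 2) (smoothOn.mk hu) = 0 := by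
  ext x
  by_cases hx : x ∈ Ω
  · have h := hΔ x hx
    rw [InnerProductSpace.laplacian_eq_iteratedFDeriv_orthonormalBasis u
      (EuclideanSpace.basisFun (Fin n) ℝ)] at h
    have h2 := ((smoothOn.mk_eqOn hu).eventuallyEq_of_mem (Ω.2.mem_nhds hx)).fderiv (𝕜 := ℝ)
    simp only [LinearMap.sum_apply, Submodule.coe_sum, Finset.sum_apply, pow_two,
      Module.End.mul_apply, partialOp_partialOp_apply _ _ _ hx, ← h2.fderiv_eq]
    simpa [iteratedFDeriv_two_apply] using h
  · exact ((∑ i, partialOp Ω i ^ 2) (smoothOn.mk hu)).2.2 x hx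

/-- Only multi-indices `α = 2γ` contribute, and there the coefficient `a^{|γ|} / γ!` is proportional
to a multinomial coefficient; so the sum over `|α| = k` is a multiple of a power of the
Laplacian. -/
theorem sum_moment_mderiv_eq_zero {u : EuclideanSpace ℝ (Fin n) → ℝ}
    (hu : ContDiffOn ℝ ∞ u Ω) (hΔ : ∀ x ∈ Ω, Laplacian.laplacian u x = 0) {c : ℕ → ℝ} {a : ℝ}
    (hodd : ∀ j, c (2 * j + 1) = 0) (heven : ∀ j, c (2 * j) = a ^ j / j !) {k : ℕ} (hk : k ≠ 0)
    {x : EuclideanSpace ℝ (Fin n)} (hx : x ∈ Ω) :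
    ∑ α ∈ multiIdx n k, mderiv α u x * ∏ i, c (α i) = 0 := by
  have hm := fun β => mderiv_eqOn_orderedMonomial β u _ (smoothOn.mk_eqOn hu) hx
  rcases Nat.even_or_odd' k with ⟨j, rfl | rfl⟩
  · have hj : j ≠ 0 := by lia
    have h0 : (((∑ i, partialOp Ω i ^ 2) ^ j) (smoothOn.mk hu) : smoothOn Ω).1 x = 0 := by
      obtain ⟨j, rfl⟩ := Nat.exists_eq_succ_of_ne_zero hj
      rw [Nat.succ_eq_add_one, pow_succ, Module.End.mul_apply,
        sum_partialOp_sq_eq_zero hu hΔ, map_zero]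
      rfl
    rw [sum_pow_eq_sum_orderedMonomial _ (fun i j => (partialOp_commute i j).pow_pow _ _)] at h0
    simp only [orderedMonomial_pow, LinearMap.sum_apply, Submodule.coe_sum, Finset.sum_apply,
      smul_eq_mul, LinearMap.smul_apply, Submodule.coe_smul, Pi.smul_apply] at h0
    have h1 : ∑ γ ∈ multiIdx n j, mderiv (fun i => 2 * γ i) u x * ∏ i, c (2 * γ i) = 0 := by
      have : ∀ γ ∈ multiIdx n j, mderiv (fun i => 2 * γ i) u x * ∏ i, c (2 * γ i) =
          (a ^ j / j !) * ((Nat.multinomial Finset.univ γ : ℝ) *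
            (orderedMonomial (partialOp Ω) (fun i => 2 * γ i) (smoothOn.mk hu)).1 x) := by
        intro γ hγ
        have h := multinomial_div_factorial hγ
        simp only [heven, Finset.prod_div_distrib, Finset.prod_pow_eq_pow_sum,
          (Finset.mem_piAntidiag.1 hγ).1]
        rw [hm, div_eq_mul_one_div (a ^ j) (∏ i, ((γ i)! : ℝ)), ← h]
        ring
      rw [Finset.sum_congr rfl this, ← Finset.mul_sum, h0, mul_zero]
    rw [← h1]
    symm
    refine Finset.sum_of_injOn (fun γ i => 2 * γ i) ?_ ?_ ?_ (fun _ _ => rfl)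
    · intro γ _ γ' _ h
      funext i
      have := congrFun h i
      simp only at this
      lia
    · intro γ hγ
      have := (Finset.mem_piAntidiag.1 hγ).1
      simp [multiIdx, ← Finset.mul_sum, this]
    · intro α hα hα'
      by_cases hall : ∀ i, Even (α i)
      · exfalso
        apply hα'
        refine ⟨fun i => α i / 2, ?_, funext fun i => Nat.two_mul_div_two_of_even (hall i)⟩
        have h2 : ∑ i, α i = 2 * j := (Finset.mem_piAntidiag.1 hα).1
        have h3 : 2 * ∑ i, α i / 2 = ∑ i, α i := by
          rw [Finset.mul_sum]
          exact Finset.sum_congr rfl fun i _ => Nat.two_mul_div_two_of_even (hall i)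
        simp [multiIdx]
        lia
      · push Not at hall
        obtain ⟨i, hi⟩ := hall
        obtain ⟨l, hl⟩ := Nat.not_even_iff_odd.1 hi
        rw [Finset.prod_eq_zero (Finset.mem_univ i) (by rw [hl, hodd]), mul_zero]
  · refine Finset.sum_eq_zero fun α hα => ?_
    have h2 : ∑ i, α i = 2 * j + 1 := (Finset.mem_piAntidiag.1 hα).1
    have : ∃ i, ¬ Even (α i) := by
      by_contra! hall
      have := Finset.even_sum (s := Finset.univ) α (fun i _ => hall i)
      rw [h2] at this
      exact absurd this (by simp)
    obtain ⟨i, hi⟩ := this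
    obtain ⟨l, hl⟩ := Nat.not_even_iff_odd.1 hi
    rw [Finset.prod_eq_zero (Finset.mem_univ i) (by rw [hl, hodd]), mul_zero]

end Operators

/-! ### Weyl's lemma -/

section Weyl

open Filter Topology Set
open scoped ContDiff InnerProductSpace

variable {E : Type*} [NormedAddCommGroup E]

/-- A smooth bump function on `ℝ`, equal to `1` near `0` and supported in `[-1, 1]`. -/
def profile : ContDiffBump (0 : ℝ) := ⟨1 / 2, 1, by norm_num, by norm_num⟩

/-- A radial smooth bump function on `E`, supported in the closed unit ball. -/
def radialBump (y : E) : ℝ := profile (‖y‖ ^ 2)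

/-- The radial function, supported in the closed unit ball, with gradient `radialBump y • y`. -/
def radialPrimitive (y : E) : ℝ := ∫ s in (1 : ℝ)..‖y‖ ^ 2, profile s / 2

theorem profile_eq_zero {s : ℝ} (hs : 1 ≤ s) : profile s = 0 :=
  profile.zero_of_le_dist (by
    rw [Real.dist_eq, sub_zero]
    exact hs.trans (le_abs_self s))

theorem radialBump_eq_zero {y : E} (hy : 1 ≤ ‖y‖) : radialBump y = 0 :=
  profile_eq_zero (one_le_pow₀ hy)

theorem radialBump_nonneg (y : E) : 0 ≤ radialBump y := profile.nonneg

theorem radialBump_zero : radialBump (0 : E) = 1 := by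
  simpa [radialBump] using profile.one_of_mem_closedBall (by simp [profile.rIn_pos.le])

theorem radialPrimitive_eq_zero {y : E} (hy : 1 ≤ ‖y‖) : radialPrimitive y = 0 := by
  refine intervalIntegral.integral_zero_ae (Eventually.of_forall fun s hs => ?_)
  rw [uIoc_of_le (one_le_pow₀ hy)] at hs
  simp [profile_eq_zero hs.1.le]

variable [InnerProductSpace ℝ E]

theorem contDiff_radialBump : ContDiff ℝ ∞ (radialBump : E → ℝ) :=
  profile.contDiff.comp (contDiff_norm_sq ℝ)

theorem hasFDerivAt_radialPrimitive (y : E) :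
    HasFDerivAt (radialPrimitive : E → ℝ) (radialBump y • innerSL ℝ y) y := by
  have hc : Continuous fun s : ℝ => profile s / 2 := profile.continuous.div_const 2
  have h1 : HasDerivAt (fun r : ℝ => ∫ s in (1 : ℝ)..r, profile s / 2) (profile (‖y‖ ^ 2) / 2)
      (‖y‖ ^ 2) := intervalIntegral.integral_hasDerivAt_right (hc.intervalIntegrable _ _)
    (hc.stronglyMeasurableAtFilter _ _) hc.continuousAt
  convert! h1.comp_hasFDerivAt y (hasStrictFDerivAt_norm_sq y).hasFDerivAt using 1
  rw [radialBump]
  ext z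
  simp
  ring

theorem fderiv_radialPrimitive (y v : E) :
    fderiv ℝ (radialPrimitive : E → ℝ) y v = radialBump y * ⟪y, v⟫_ℝ := by
  rw [(hasFDerivAt_radialPrimitive y).fderiv]
  simp

variable [FiniteDimensional ℝ E]

theorem hasCompactSupport_of_unitBall {f : E → ℝ} (hf : ∀ y, 1 ≤ ‖y‖ → f y = 0) :
    HasCompactSupport f :=
  HasCompactSupport.intro (isCompact_closedBall (0 : E) 1) fun y hy =>
    hf y (by simpa using (not_le.1 (by simpa using hy)).le)

variable [MeasurableSpace E] [BorelSpace E]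

theorem integral_radialBump_pos : 0 < ∫ y : E, radialBump y :=
  contDiff_radialBump.continuous.integral_pos_of_hasCompactSupport_nonneg_nonzero
    (hasCompactSupport_of_unitBall fun _ => radialBump_eq_zero) radialBump_nonneg
    (x := 0) (by simp [radialBump_zero])

/-- The derivative in `t` of the radial mean `∫ v (x - t y) φ(y) dy` is, by parts,
`t ∫ Δv (x - t y) Ψ(y) dy`, where `∇Ψ(y) = φ(y) y`. -/
theorem integral_fderiv_mul_radialBump_eq_zero {v : E → ℝ} (hv : ContDiff ℝ 2 v) (x : E) {r t : ℝ}
    (ht : t ∈ Icc 0 r) (hr : 0 < r) (hΔ : ∀ z ∈ Metric.ball x r, Laplacian.laplacian v z = 0) :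
    ∫ y, fderiv ℝ v (x - t • y) y * radialBump y = 0 := by
  set b := stdOrthonormalBasis ℝ E
  have hv1 : ContDiff ℝ 1 (fderiv ℝ v) := hv.fderiv_right (by norm_num)
  have hsm : ∀ e : E, ContDiff ℝ 1 fun y => fderiv ℝ v (x - t • y) e := fun e =>
    (hv1.comp (contDiff_const.sub (contDiff_const.smul contDiff_id))).clm_apply contDiff_const
  have hΨd : Differentiable ℝ (radialPrimitive : E → ℝ) := fun y =>
    (hasFDerivAt_radialPrimitive y).differentiableAt
  have hΨs : HasCompactSupport (radialPrimitive : E → ℝ) :=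
    hasCompactSupport_of_unitBall fun _ => radialPrimitive_eq_zero
  have hφs : HasCompactSupport (radialBump : E → ℝ) :=
    hasCompactSupport_of_unitBall fun _ => radialBump_eq_zero
  have hφc : Continuous (radialBump : E → ℝ) := contDiff_radialBump.continuous
  have hd2 : ∀ y e, fderiv ℝ (fun y => fderiv ℝ v (x - t • y) e) y e =
      -t * fderiv ℝ (fderiv ℝ v) (x - t • y) e e := by
    intro y e
    have h1 : HasFDerivAt (fun y : E => x - t • y) (-(t • ContinuousLinearMap.id ℝ E)) y :=
      ((hasFDerivAt_id y).const_smul t).const_sub x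
    have h2 := ((hv1.differentiable (by simp)) (x - t • y)).hasFDerivAt.comp y h1
    have h3 := h2.clm_apply (hasFDerivAt_const e y)
    have h4 : HasFDerivAt (fun y => fderiv ℝ v (x - t • y) e) _ y := h3
    rw [h4.fderiv]
    simp
  have hparts : ∀ e : E, ∫ y, fderiv ℝ v (x - t • y) e * fderiv ℝ radialPrimitive y e =
      t * ∫ y, fderiv ℝ (fderiv ℝ v) (x - t • y) e e * radialPrimitive y := by
    intro e
    have hc2 : Continuous fun y => fderiv ℝ (fderiv ℝ v) (x - t • y) e e :=
      (((hv1.continuous_fderiv (by simp)).comp (by fun_prop)).clm_apply continuous_const).clm_apply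
        continuous_const
    rw [integral_mul_fderiv_eq_neg_fderiv_mul_of_integrable]
    · simp only [hd2]
      rw [← integral_const_mul, ← integral_neg]
      congr 1 with y
      ring
    · simp only [hd2]
      exact ((continuous_const.mul hc2).mul hΨd.continuous).integrable_of_hasCompactSupport
        hΨs.mul_left
    · simp only [fderiv_radialPrimitive]
      exact ((hsm e).continuous.mul (hφc.mul
        (by fun_prop))).integrable_of_hasCompactSupport hφs.mul_right.mul_left
    · exact ((hsm e).continuous.mul hΨd.continuous).integrable_of_hasCompactSupport hΨs.mul_left
    · exact fun y _ => (hsm e).differentiable (by simp) y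
    · exact fun y _ => hΨd y
  have hint : ∀ e : E,
      Integrable fun y => fderiv ℝ v (x - t • y) e * fderiv ℝ radialPrimitive y e := by
    intro e
    simp only [fderiv_radialPrimitive]
    exact ((hsm e).continuous.mul (hφc.mul
      (by fun_prop))).integrable_of_hasCompactSupport hφs.mul_right.mul_left
  have hint2 : ∀ e : E, Integrable fun y =>
      fderiv ℝ (fderiv ℝ v) (x - t • y) e e * radialPrimitive y := by
    intro e
    have hc2 : Continuous fun y => fderiv ℝ (fderiv ℝ v) (x - t • y) e e :=
      (((hv1.continuous_fderiv (by simp)).comp (by fun_prop)).clm_apply continuous_const).clm_apply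
        continuous_const
    exact (hc2.mul hΨd.continuous).integrable_of_hasCompactSupport hΨs.mul_left
  have hexp : ∀ y, fderiv ℝ v (x - t • y) y * radialBump y =
      ∑ i, fderiv ℝ v (x - t • y) (b i) * fderiv ℝ radialPrimitive y (b i) := by
    intro y
    have hA : ∀ A : E →L[ℝ] ℝ, A y = ∑ i, ⟪b i, y⟫_ℝ * A (b i) := fun A => by
      conv_lhs => rw [← b.sum_repr' y]
      simp
    rw [hA, Finset.sum_mul]
    refine Finset.sum_congr rfl fun i _ => ?_
    rw [fderiv_radialPrimitive, real_inner_comm]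
    ring
  simp only [hexp]
  rw [integral_finsetSum _ fun i _ => hint _]
  simp only [hparts]
  rw [← Finset.mul_sum, ← integral_finsetSum _ fun i _ => hint2 _]
  have hz : ∀ y : E,
      ∑ i, fderiv ℝ (fderiv ℝ v) (x - t • y) (b i) (b i) * radialPrimitive y = 0 := by
    intro y
    rw [← Finset.sum_mul]
    rcases le_or_gt 1 ‖y‖ with hy | hy
    · rw [radialPrimitive_eq_zero hy, mul_zero]
    · have hmem : x - t • y ∈ Metric.ball x r := by
        rw [mem_ball_iff_norm, sub_sub_cancel_left, norm_neg, norm_smul, Real.norm_of_nonneg ht.1]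
        calc t * ‖y‖ ≤ r * ‖y‖ := by gcongr; exact ht.2
          _ < r * 1 := by gcongr
          _ = r := mul_one r
      have := hΔ _ hmem
      rw [InnerProductSpace.laplacian_eq_iteratedFDeriv_orthonormalBasis v b] at this
      simp only [iteratedFDeriv_two_apply] at this
      simp only [Matrix.cons_val_zero, Matrix.cons_val_one] at this
      rw [this, zero_mul]
  simp only [hz, integral_zero, mul_zero]

/-- The mean value property for means with a radial weight: the mean over scale `t` has zero
derivative in `t`, so its values at `t = r` and `t = 0` agree. -/
theorem integral_radialBump_eq {v : E → ℝ} (hv : ContDiff ℝ 2 v) (hvs : HasCompactSupport v) (x : E)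
    {r : ℝ} (hr : 0 < r) (hΔ : ∀ z ∈ Metric.ball x r, Laplacian.laplacian v z = 0) :
    ∫ y, v (x - r • y) * radialBump y = v x * ∫ y : E, radialBump y := by
  have hv1 : Continuous (fderiv ℝ v) := hv.continuous_fderiv (by simp)
  have hφs : HasCompactSupport (radialBump : E → ℝ) :=
    hasCompactSupport_of_unitBall fun _ => radialBump_eq_zero
  have hφc : Continuous (radialBump : E → ℝ) := contDiff_radialBump.continuous
  have hφi : Integrable (radialBump : E → ℝ) := hφc.integrable_of_hasCompactSupport hφs
  obtain ⟨K, hK⟩ := (hvs.fderiv (𝕜 := ℝ)).exists_bound_of_continuous hv1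
  have hderiv : ∀ t : ℝ, HasDerivAt (fun t => ∫ y, v (x - t • y) * radialBump y)
      (∫ y, -(fderiv ℝ v (x - t • y) y * radialBump y)) t := by
    intro t
    refine (hasDerivAt_integral_of_dominated_loc_of_deriv_le (s := univ) univ_mem
      (F := fun t y => v (x - t • y) * radialBump y)
      (F' := fun t y => -(fderiv ℝ v (x - t • y) y * radialBump y))
      (bound := fun y => K * radialBump y) ?_ ?_ ?_ ?_ ?_ ?_).2
    · exact Eventually.of_forall fun s =>
        ((hv.continuous.comp (by fun_prop)).mul hφc).aestronglyMeasurable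
    · exact ((hv.continuous.comp (by fun_prop)).mul hφc).integrable_of_hasCompactSupport
        hφs.mul_left
    · exact (((hv1.comp (by fun_prop)).clm_apply continuous_id).mul hφc).neg.aestronglyMeasurable
    · refine Eventually.of_forall fun y s _ => ?_
      rw [norm_neg, norm_mul, Real.norm_of_nonneg (radialBump_nonneg y)]
      rcases le_or_gt 1 ‖y‖ with hy | hy
      · simp [radialBump_eq_zero hy]
      · gcongr
        · exact radialBump_nonneg y
        · exact ((fderiv ℝ v (x - s • y)).le_of_opNorm_le (hK _) y).trans
            (mul_le_of_le_one_right ((norm_nonneg _).trans (hK 0)) hy.le)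
    · exact hφi.const_mul K
    · refine Eventually.of_forall fun y s _ => ?_
      have h1 : HasDerivAt (fun s : ℝ => x - s • y) (-y) s := by
        simpa using ((hasDerivAt_id s).smul_const y).const_sub x
      have h2 := ((hv.differentiable (by simp)) (x - s • y)).hasFDerivAt.comp_hasDerivAt s h1
      simpa using h2.mul_const (radialBump y)
  have h0 := constant_of_has_deriv_right_zero (a := (0 : ℝ)) (b := r)
    (fun t _ => (hderiv t).continuousAt.continuousWithinAt)
    (fun t ht => by
      have := (hderiv t).hasDerivWithinAt (s := Ici t)
      rwa [integral_neg, integral_fderiv_mul_radialBump_eq_zero hv x (Ico_subset_Icc_self ht) hr hΔ,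
        neg_zero] at this) r (right_mem_Icc.2 hr.le)
  rw [h0]
  simp [integral_const_mul]

/-- **Weyl's lemma**: a harmonic function is smooth. -/
theorem contDiffOn_of_harmonicOnNhd {u : E → ℝ} {Ω : Set E} (hΩ : IsOpen Ω)
    (hu : InnerProductSpace.HarmonicOnNhd u Ω) : ContDiffOn ℝ ∞ u Ω := by
  intro x₀ hx₀
  obtain ⟨R, hR, hRΩ⟩ := Metric.isOpen_iff.1 hΩ x₀ hx₀
  obtain ⟨r, hr, rfl⟩ : ∃ r, 0 < r ∧ R = 4 * r := ⟨R / 4, by positivity, by ring⟩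
  -- Cutting `u` off outside a neighbourhood of `x₀` gives a function that is `C²` on all of `E`.
  let χ : ContDiffBump x₀ := ⟨2 * r, 3 * r, by positivity, by linarith⟩
  set v : E → ℝ := fun x => χ x * u x with hv_def
  have hvs : HasCompactSupport v := χ.hasCompactSupport.mul_right
  have hv : ContDiff ℝ 2 v := by
    rw [contDiff_iff_contDiffAt]
    intro x
    by_cases hx : x ∈ Ω
    · exact χ.contDiffAt.mul (hu x hx).1
    · have hxs : x ∉ tsupport χ := fun h => hx (hRΩ (by
        rw [χ.tsupport_eq] at h
        exact Metric.closedBall_subset_ball (by change 3 * r < 4 * r; linarith) h))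
      have : v =ᶠ[𝓝 x] fun _ => 0 := by
        filter_upwards [notMem_tsupport_iff_eventuallyEq.1 hxs] with y hy
        simp [hv_def, hy]
      exact contDiffAt_const.congr_of_eventuallyEq this
  have hvu : EqOn v u (Metric.ball x₀ (2 * r)) := fun y hy => by
    simp [hv_def, χ.one_of_mem_closedBall (Metric.ball_subset_closedBall hy)]
  have hΔ : ∀ z ∈ Metric.ball x₀ (2 * r), Laplacian.laplacian v z = 0 := by
    intro z hz
    have h1 := InnerProductSpace.laplacian_congr_nhds
      (hvu.eventuallyEq_of_mem (Metric.isOpen_ball.mem_nhds hz))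
    rw [h1.eq_of_nhds]
    exact (hu z (hRΩ (Metric.ball_subset_ball (by linarith) hz))).2.eq_of_nhds
  set ρ : E → ℝ := fun z => radialBump (r⁻¹ • z) with hρ
  have hρs : HasCompactSupport ρ :=
    (hasCompactSupport_of_unitBall fun _ => radialBump_eq_zero).comp_smul (inv_ne_zero hr.ne')
  have hρc : ContDiff ℝ ∞ ρ := contDiff_radialBump.comp (contDiff_const.smul contDiff_id)
  have hconv : ContDiff ℝ ∞ (MeasureTheory.convolution ρ v (ContinuousLinearMap.mul ℝ ℝ) volume) :=
    hρs.contDiff_convolution_left _ hρc hv.continuous.locallyIntegrable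
  have hmean : ∀ x ∈ Metric.ball x₀ r, u x = |(r ^ Module.finrank ℝ E)⁻¹| *
      MeasureTheory.convolution ρ v (ContinuousLinearMap.mul ℝ ℝ) volume x /
        ∫ y : E, radialBump y := by
    intro x hx
    have h1 := integral_radialBump_eq hv hvs x hr fun z hz => hΔ z (by
      rw [Metric.mem_ball] at *
      linarith [dist_triangle z x x₀])
    have h2 := Measure.integral_comp_smul volume (fun s : E => v (x - s) * ρ s) r
    have h3 : ∀ y : E, ρ (r • y) = radialBump y := fun y => by
      simp [hρ, smul_smul, hr.ne']
    simp only [h3] at h2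
    rw [eq_div_iff integral_radialBump_pos.ne', ← hvu (Metric.ball_subset_ball (by linarith) hx),
      ← h1, h2, smul_eq_mul]
    congr 2 with s
    simp [mul_comm]
  refine ContDiffAt.contDiffWithinAt ?_
  refine ContDiffAt.congr_of_eventuallyEq
    (((contDiff_const (c := |(r ^ Module.finrank ℝ E)⁻¹|)).mul hconv).div_const
      (∫ y : E, radialBump y)).contDiffAt ?_
  filter_upwards [Metric.ball_mem_nhds x₀ hr] with x hx using hmean x hx

end Weyl

/-! ### One-dimensional discrete Gaussian moments -/

section OneDimensional

open Filter Topology Set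

/-- The error of the Riemann sum of mesh one is at most the total variation: on `[m, m + 1]` the
function differs from `f m` by at most `∫ |f'|` over that interval. -/
theorem summable_int_and_abs_tsum_sub_integral_le {f f' : ℝ → ℝ}
    (hf : ∀ x, HasDerivAt f (f' x) x) (hc : Continuous f') (hi : Integrable f)
    (hi' : Integrable f') :
    (Summable fun m : ℤ => f m) ∧ |∑' m : ℤ, f m - ∫ x, f x| ≤ ∫ x, |f' x| := by
  have ha := hi.hasSum_intervalIntegral 0
  have hb := hi'.abs.hasSum_intervalIntegral 0
  simp only [zero_add] at ha hb
  have hfc : Continuous f := continuous_iff_continuousAt.2 fun x => (hf x).continuousAt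
  have hle : ∀ m : ℤ, ‖f m - ∫ x in (m : ℝ)..m + 1, f x‖ ≤ ∫ x in (m : ℝ)..m + 1, |f' x| := by
    intro m
    have h1 : f m - ∫ x in (m : ℝ)..m + 1, f x = ∫ x in (m : ℝ)..m + 1, (f m - f x) := by
      rw [intervalIntegral.integral_sub (by simp) (hfc.intervalIntegrable _ _)]
      simp
    rw [h1]
    refine (intervalIntegral.norm_integral_le_of_norm_le_const
      (C := ∫ x in (m : ℝ)..m + 1, |f' x|) fun x hx => ?_).trans (by simp)
    rw [uIoc_of_le (by linarith)] at hx
    rw [norm_sub_rev, ← intervalIntegral.integral_eq_sub_of_hasDerivAt (fun y _ => hf y)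
      (hc.intervalIntegrable _ _)]
    refine (intervalIntegral.norm_integral_le_integral_norm hx.1.le).trans ?_
    exact intervalIntegral.integral_mono_interval le_rfl hx.1.le hx.2
      (Eventually.of_forall fun y => abs_nonneg _) (hc.abs.intervalIntegrable _ _)
  have hs : Summable fun m : ℤ => f m - ∫ x in (m : ℝ)..m + 1, f x :=
    Summable.of_norm_bounded hb.summable hle
  have hsf : Summable fun m : ℤ => f m := by simpa using hs.add ha.summable
  refine ⟨hsf, ?_⟩
  rw [← ha.tsum_eq, ← hsf.tsum_sub ha.summable, ← hb.tsum_eq]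
  exact tsum_of_norm_bounded hb.summable.hasSum hle

/-- The function `y ↦ y^k exp(-y²)`. -/
def gaussMonomial (k : ℕ) (y : ℝ) : ℝ := y ^ k * Real.exp (-y ^ 2)

theorem continuous_gaussMonomial (k : ℕ) : Continuous (gaussMonomial k) := by
  unfold gaussMonomial; fun_prop

theorem integrable_gaussMonomial (k : ℕ) : Integrable (gaussMonomial k) := by
  have := integrable_rpow_mul_exp_neg_mul_sq (b := 1) one_pos (s := k)
    (by have : (0 : ℝ) ≤ k := by positivity
        linarith)
  change Integrable fun y : ℝ => y ^ k * Real.exp (-y ^ 2)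
  simpa [Real.rpow_natCast] using this

theorem hasDerivAt_gaussMonomial (k : ℕ) (y : ℝ) :
    HasDerivAt (gaussMonomial k) (k * gaussMonomial (k - 1) y - 2 * gaussMonomial (k + 1) y) y := by
  have h1 := (hasDerivAt_pow k y).mul ((hasDerivAt_pow 2 y).neg.exp)
  convert! h1 using 1
  simp only [gaussMonomial, Pi.neg_apply]
  push_cast
  ring

/-- The `k`-th moment of the probability density `π^{-1/2} exp(-y²)`. -/
def gaussMoment (k : ℕ) : ℝ := (√Real.pi)⁻¹ * ∫ y, gaussMonomial k y

theorem integrable_deriv_gaussMonomial (k : ℕ) :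
    Integrable fun y => k * gaussMonomial (k - 1) y - 2 * gaussMonomial (k + 1) y :=
  ((integrable_gaussMonomial _).const_mul _).sub ((integrable_gaussMonomial _).const_mul _)

/-- Integration by parts: the derivative of `y^k exp(-y²)` has integral zero. -/
theorem gaussMoment_recurrence (k : ℕ) :
    k * gaussMoment (k - 1) = 2 * gaussMoment (k + 1) := by
  have h := integral_eq_zero_of_hasDerivAt_of_integrable (hasDerivAt_gaussMonomial k)
    (integrable_deriv_gaussMonomial k) (integrable_gaussMonomial k)
  rw [integral_sub ((integrable_gaussMonomial _).const_mul _)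
    ((integrable_gaussMonomial _).const_mul _), integral_const_mul, integral_const_mul] at h
  simp only [gaussMoment]
  linear_combination (√Real.pi)⁻¹ * h

theorem gaussMoment_zero : gaussMoment 0 = 1 := by
  have h := integral_gaussian 1
  simp only [neg_mul, one_mul, div_one] at h
  simp only [gaussMoment, gaussMonomial, pow_zero, one_mul, h]
  exact inv_mul_cancel₀ (Real.sqrt_pos.2 Real.pi_pos).ne'

theorem gaussMoment_odd (j : ℕ) : gaussMoment (2 * j + 1) = 0 := by
  induction j with
  | zero => simpa using (gaussMoment_recurrence 0).symm
  | succ j ih =>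
    have h := gaussMoment_recurrence (2 * j + 2)
    rw [show 2 * j + 2 - 1 = 2 * j + 1 by lia, ih] at h
    rw [show 2 * (j + 1) + 1 = 2 * j + 2 + 1 by ring]
    linarith

theorem gaussMoment_even_succ (j : ℕ) :
    gaussMoment (2 * (j + 1)) = (2 * j + 1) / 2 * gaussMoment (2 * j) := by
  have h := gaussMoment_recurrence (2 * j + 1)
  rw [show 2 * j + 1 - 1 = 2 * j by lia] at h
  rw [show 2 * (j + 1) = 2 * j + 1 + 1 by ring]
  push_cast at h
  linarith

theorem gaussMoment_even_div_factorial (j : ℕ) :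
    gaussMoment (2 * j) / (2 * j)! = (1 / 4) ^ j / j ! := by
  induction j with
  | zero => simp [gaussMoment_zero]
  | succ j ih =>
    have h1 : ((2 * j)! : ℝ) ≠ 0 := by positivity
    have h2 : (j ! : ℝ) ≠ 0 := by positivity
    rw [div_eq_div_iff h1 h2] at ih
    rw [gaussMoment_even_succ, show 2 * (j + 1) = 2 * j + 1 + 1 by ring, Nat.factorial_succ,
      Nat.factorial_succ, Nat.factorial_succ, pow_succ]
    push_cast
    rw [div_eq_div_iff (by positivity) (by positivity)]
    linear_combination (2 * (j : ℝ) + 1) / 2 * (j + 1) * ih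

theorem gaussMoment_even_le (j : ℕ) : gaussMoment (2 * j) ≤ j ! := by
  induction j with
  | zero => simp [gaussMoment_zero]
  | succ j ih =>
    rw [gaussMoment_even_succ, Nat.factorial_succ]
    push_cast
    calc (2 * (j : ℝ) + 1) / 2 * gaussMoment (2 * j) ≤ (2 * (j : ℝ) + 1) / 2 * j ! := by gcongr
      _ ≤ (j + 1) * j ! := by gcongr; linarith

/-- The position of the `m`-th integer relative to `s`, in units of `√D`. -/
def node (D s : ℝ) (m : ℤ) : ℝ := (m - s) / √D

/-- The one-dimensional weight `(π D)^{-1/2} exp(-(m - s)² / D)`. -/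
def weight (D s : ℝ) (m : ℤ) : ℝ := (√(Real.pi * D))⁻¹ * Real.exp (-node D s m ^ 2)

theorem weight_nonneg (D s : ℝ) (m : ℤ) : 0 ≤ weight D s m := by
  unfold weight; positivity

/-- The discrete moment is a Riemann sum of mesh `1 / √D` for the Gaussian moment; its error is
`O(1 / √D)` with a constant independent of the shift `s`. -/
theorem summable_and_abs_discreteMoment_sub_le (k : ℕ) {D : ℝ} (hD : 0 < D) (s : ℝ) :
    (Summable fun m : ℤ => node D s m ^ k * weight D s m) ∧
    |∑' m : ℤ, node D s m ^ k * weight D s m - gaussMoment k| ≤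
      (∫ y, |k * gaussMonomial (k - 1) y - 2 * gaussMonomial (k + 1) y|) * (√(Real.pi * D))⁻¹ := by
  have hr : 0 < √D := Real.sqrt_pos.2 hD
  have hpi : 0 < √Real.pi := Real.sqrt_pos.2 Real.pi_pos
  have hint : ∀ g : ℝ → ℝ, ∫ x, g ((x - s) / √D) = √D * ∫ y, g y := fun g => by
    rw [integral_sub_right_eq_self (fun x => g (x / √D)) s, Measure.integral_comp_div g,
      abs_of_pos hr, smul_eq_mul]
  have hintg : ∀ g : ℝ → ℝ, Integrable g → Integrable fun x => g ((x - s) / √D) := fun g hg =>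
    (hg.comp_div hr.ne').comp_sub_right s
  have hcont : Continuous fun y => k * gaussMonomial (k - 1) y - 2 * gaussMonomial (k + 1) y :=
    ((continuous_gaussMonomial _).const_mul _).sub ((continuous_gaussMonomial _).const_mul _)
  have key := summable_int_and_abs_tsum_sub_integral_le
    (f := fun x => gaussMonomial k ((x - s) / √D))
    (f' := fun x => (k * gaussMonomial (k - 1) ((x - s) / √D) -
      2 * gaussMonomial (k + 1) ((x - s) / √D)) * (1 / √D))
    (fun x => (hasDerivAt_gaussMonomial k _).comp x
      (((hasDerivAt_id x).sub_const s).div_const √D))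
    ((hcont.comp (by fun_prop)).mul_const _)
    (hintg _ (integrable_gaussMonomial k))
    ((hintg _ (integrable_deriv_gaussMonomial k)).mul_const _)
  have hterm : ∀ m : ℤ, node D s m ^ k * weight D s m =
      (√(Real.pi * D))⁻¹ * gaussMonomial k ((m - s) / √D) := fun m => by
    simp only [weight, gaussMonomial, node]; ring
  simp only [hterm]
  refine ⟨key.1.mul_left _, ?_⟩
  have h2 := key.2
  simp only [abs_mul, hint (gaussMonomial k), integral_mul_const] at h2
  rw [hint (fun y => |k * gaussMonomial (k - 1) y - 2 * gaussMonomial (k + 1) y|),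
    abs_of_pos (by positivity : 0 < 1 / √D), mul_one_div, mul_div_cancel_left₀ _ hr.ne'] at h2
  have h3 : gaussMoment k = (√(Real.pi * D))⁻¹ * (√D * ∫ y, gaussMonomial k y) := by
    rw [gaussMoment, Real.sqrt_mul Real.pi_pos.le]
    field_simp
  rw [tsum_mul_left, h3, ← mul_sub, abs_mul, abs_of_nonneg (by positivity), mul_comm]
  gcongr

/-- The discrete moments converge to the Gaussian moments as `D → ∞`, uniformly in the shift. -/
theorem tendsto_discreteMoment (k : ℕ) :
    Tendsto (fun p : ℝ × ℝ => ∑' m : ℤ, node p.1 p.2 m ^ k * weight p.1 p.2 m) (atTop ×ˢ ⊤)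
      (𝓝 (gaussMoment k)) := by
  rw [tendsto_iff_norm_sub_tendsto_zero]
  have h0 : Tendsto (fun D : ℝ =>
      (∫ y, |k * gaussMonomial (k - 1) y - 2 * gaussMonomial (k + 1) y|) * (√(Real.pi * D))⁻¹)
      atTop (𝓝 0) := by
    rw [← mul_zero (∫ y, |k * gaussMonomial (k - 1) y - 2 * gaussMonomial (k + 1) y|)]
    exact (tendsto_inv_atTop_zero.comp (Real.tendsto_sqrt_atTop.comp
      (tendsto_id.const_mul_atTop Real.pi_pos))).const_mul _
  refine squeeze_zero' (Eventually.of_forall fun _ => norm_nonneg _) ?_ (h0.comp tendsto_fst)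
  filter_upwards [tendsto_fst.eventually (eventually_gt_atTop (0 : ℝ))] with p hp
  exact (summable_and_abs_discreteMoment_sub_le k hp p.2).2

theorem summable_abs_node_pow_mul_weight (k : ℕ) {D : ℝ} (hD : 0 < D) (s : ℝ) :
    Summable fun m : ℤ => |node D s m| ^ k * weight D s m := by
  refine (summable_and_abs_discreteMoment_sub_le k hD s).1.abs.congr fun m => ?_
  rw [abs_mul, abs_pow, abs_of_nonneg (weight_nonneg D s m)]

theorem eventually_forall_of_eventually_prod_top {α β : Type*} {l : Filter α} {p : α × β → Prop}
    (h : ∀ᶠ x in l ×ˢ (⊤ : Filter β), p x) : ∀ᶠ a in l, ∀ b, p (a, b) := by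
  rw [← principal_univ, eventually_prod_principal_iff] at h
  simpa using h

/-- A bound for the absolute moments of order `b`: its quotient by `b!` is the factor
`√(2 / (b - 1)!)` occurring in `cConst` if `0 < b`. -/
def momentBound (b : ℕ) : ℝ := if 0 < b then b ! * √(2 / ((b - 1)! : ℝ)) else 2

theorem momentBound_nonneg (b : ℕ) : 0 ≤ momentBound b := by
  unfold momentBound; split_ifs <;> positivity

/-- By the arithmetic-geometric mean inequality `|y|^b ≤ (λ y^{2b-2} + λ⁻¹ y²) / 2`, which for
`λ = (b - 1)!^{-1/2}` bounds the absolute moments of the Gaussian by those of even order. -/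
theorem eventually_absMoment_le (b : ℕ) :
    ∀ᶠ D : ℝ in atTop, ∀ s : ℝ, ∑' m : ℤ, |node D s m| ^ b * weight D s m ≤ momentBound b := by
  rcases Nat.eq_zero_or_pos b with rfl | hb
  · have h := (tendsto_discreteMoment 0).eventually_le_const (u := 2)
      (by rw [gaussMoment_zero]; norm_num)
    filter_upwards [eventually_forall_of_eventually_prod_top h] with D hD s
    simpa [momentBound] using hD s
  obtain ⟨c, rfl⟩ : ∃ c, b = c + 1 := ⟨b - 1, by lia⟩
  set q : ℝ := √(c ! : ℝ) with hq
  have hq0 : 0 < q := Real.sqrt_pos.2 (by positivity)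
  have hqq : q * q = c ! := Real.mul_self_sqrt (by positivity)
  have hlim : Tendsto (fun p : ℝ × ℝ =>
      (q⁻¹ * ∑' m : ℤ, node p.1 p.2 m ^ (2 * c) * weight p.1 p.2 m +
        q * ∑' m : ℤ, node p.1 p.2 m ^ 2 * weight p.1 p.2 m) / 2) (atTop ×ˢ ⊤)
      (𝓝 ((q⁻¹ * gaussMoment (2 * c) + q * gaussMoment 2) / 2)) :=
    (((tendsto_discreteMoment (2 * c)).const_mul _).add
      ((tendsto_discreteMoment 2).const_mul _)).div_const 2
  have hlt : (q⁻¹ * gaussMoment (2 * c) + q * gaussMoment 2) / 2 < momentBound (c + 1) := by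
    have h2 : gaussMoment 2 = 1 / 2 := by simpa [gaussMoment_zero] using gaussMoment_even_succ 0
    have h3 : q⁻¹ * gaussMoment (2 * c) ≤ q := by
      rw [inv_mul_le_iff₀ hq0, hqq]
      exact gaussMoment_even_le c
    have h4 : q * 1 ≤ momentBound (c + 1) := by
      rw [momentBound, if_pos (by lia), Nat.add_sub_cancel, Real.sqrt_div (by norm_num), ← hq,
        Nat.factorial_succ]
      push_cast
      rw [← hqq, show ((c : ℝ) + 1) * (q * q) * (√2 / q) = q * ((c + 1) * √2) by field_simp]
      gcongr
      have : (1 : ℝ) ≤ √2 := Real.one_le_sqrt.2 (by norm_num)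
      have hc : (0 : ℝ) ≤ c := by positivity
      nlinarith
    rw [h2]
    linarith
  filter_upwards [eventually_forall_of_eventually_prod_top (hlim.eventually_le_const hlt),
    eventually_gt_atTop (0 : ℝ)] with D hD hD0 s
  refine le_trans ?_ (hD s)
  have s1 := (summable_and_abs_discreteMoment_sub_le (2 * c) hD0 s).1
  have s2 := (summable_and_abs_discreteMoment_sub_le 2 hD0 s).1
  rw [← tsum_mul_left, ← tsum_mul_left, ← (s1.mul_left _).tsum_add (s2.mul_left _),
    ← tsum_div_const]
  refine (summable_abs_node_pow_mul_weight _ hD0 s).tsum_le_tsum (fun m => ?_)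
    (((s1.mul_left _).add (s2.mul_left _)).div_const 2)
  have hw := weight_nonneg D s m
  set y := node D s m
  have h1 : |y| ^ (c + 1) ≤ (q⁻¹ * y ^ (2 * c) + q * y ^ 2) / 2 := by
    have h5 : (|y| ^ c) ^ 2 = y ^ (2 * c) := by
      rw [← pow_mul, mul_comm c 2, pow_mul, sq_abs, pow_mul]
    rw [← h5, ← sq_abs y, pow_succ]
    have h6 : 0 ≤ q⁻¹ * (|y| ^ c - q * |y|) ^ 2 := by positivity
    have h7 : q⁻¹ * (|y| ^ c - q * |y|) ^ 2 =
        q⁻¹ * (|y| ^ c) ^ 2 + q * |y| ^ 2 - 2 * (|y| ^ c * |y|) := by field_simp; ring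
    linarith
  calc |y| ^ (c + 1) * weight D s m ≤ (q⁻¹ * y ^ (2 * c) + q * y ^ 2) / 2 * weight D s m := by
        gcongr
    _ = _ := by ring

end OneDimensional

/-! ### Discrete moments on the lattice and truncation to the domain -/

section Lattice

open Filter Topology Set

theorem hasSum_fin_prod {ι : Type*} {n : ℕ} (F : Fin n → ι → ℝ) (hF : ∀ i, Summable (F i)) :
    HasSum (fun m : Fin n → ι => ∏ i, F i (m i)) (∏ i, ∑' k, F i k) := by
  induction n with
  | zero => simp
  | succ n ih =>
    have ih' := ih (fun i : Fin n => F i.succ) fun i => hF i.succ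
    have h0 : Summable fun k => ‖F 0 k‖ := (hF 0).norm
    have h1 : Summable fun m : Fin n → ι => ‖∏ i : Fin n, F i.succ (m i)‖ := ih'.summable.norm
    have h2 := summable_mul_of_summable_norm h0 h1
    have h3 := (hF 0).hasSum.mul ih' h2
    rw [← (Fin.consEquiv fun _ => ι).hasSum_iff, Fin.prod_univ_succ]
    refine h3.congr_fun fun p => ?_
    simp [Fin.prod_univ_succ, Fin.consEquiv]

variable {n : ℕ}

theorem hasSum_multi_node (α : Fin n → ℕ) {D : ℝ} (hD : 0 < D) (s : Fin n → ℝ) :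
    HasSum (fun m : Fin n → ℤ => ∏ i, node D (s i) (m i) ^ α i * weight D (s i) (m i))
      (∏ i, ∑' k, node D (s i) k ^ α i * weight D (s i) k) :=
  hasSum_fin_prod (fun i k => node D (s i) k ^ α i * weight D (s i) k) fun i =>
    (summable_and_abs_discreteMoment_sub_le (α i) hD (s i)).1

theorem hasSum_multi_abs_node (α : Fin n → ℕ) {D : ℝ} (hD : 0 < D) (s : Fin n → ℝ) :
    HasSum (fun m : Fin n → ℤ => ∏ i, |node D (s i) (m i)| ^ α i * weight D (s i) (m i))
      (∏ i, ∑' k, |node D (s i) k| ^ α i * weight D (s i) k) :=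
  hasSum_fin_prod (fun i k => |node D (s i) k| ^ α i * weight D (s i) k) fun i =>
    summable_abs_node_pow_mul_weight (α i) hD (s i)

theorem eventually_multi_moment (α : Fin n → ℕ) {ε : ℝ} (hε : 0 < ε) :
    ∀ᶠ D : ℝ in atTop, ∀ s : Fin n → ℝ,
      |∑' m : Fin n → ℤ, ∏ i, node D (s i) (m i) ^ α i * weight D (s i) (m i) -
        ∏ i, gaussMoment (α i)| ≤ ε := by
  have h : Tendsto (fun p : ℝ × (Fin n → ℝ) =>
      ∏ i, ∑' k : ℤ, node p.1 (p.2 i) k ^ α i * weight p.1 (p.2 i) k) (atTop ×ˢ ⊤)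
      (𝓝 (∏ i, gaussMoment (α i))) := by
    have hi : ∀ i ∈ Finset.univ, Tendsto (fun p : ℝ × (Fin n → ℝ) =>
        ∑' k : ℤ, node p.1 (p.2 i) k ^ α i * weight p.1 (p.2 i) k) (atTop ×ˢ ⊤)
        (𝓝 (gaussMoment (α i))) := fun i _ => by
      have hp : Tendsto (fun p : ℝ × (Fin n → ℝ) => (p.1, p.2 i)) (atTop ×ˢ ⊤) (atTop ×ˢ ⊤) :=
        tendsto_fst.prodMk tendsto_top
      have hc := (tendsto_discreteMoment (α i)).comp hp
      exact hc
    exact tendsto_finsetProd _ hi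
  have h1 := h.eventually (Metric.closedBall_mem_nhds _ hε)
  filter_upwards [eventually_forall_of_eventually_prod_top h1, eventually_gt_atTop (0 : ℝ)]
    with D hD hD0 s
  rw [(hasSum_multi_node α hD0 s).tsum_eq]
  exact hD s

theorem eventually_multi_absMoment_le (β : Fin n → ℕ) :
    ∀ᶠ D : ℝ in atTop, ∀ s : Fin n → ℝ,
      ∑' m : Fin n → ℤ, ∏ i, |node D (s i) (m i)| ^ β i * weight D (s i) (m i) ≤
        ∏ i, momentBound (β i) := by
  filter_upwards [eventually_all.2 fun i => eventually_absMoment_le (β i),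
    eventually_gt_atTop (0 : ℝ)] with D hD hD0 s
  rw [(hasSum_multi_abs_node β hD0 s).tsum_eq]
  refine Finset.prod_le_prod (fun i _ => tsum_nonneg fun k => ?_) fun i _ => hD i (s i)
  exact mul_nonneg (by positivity) (weight_nonneg _ _ _)

theorem sum_sq_le_prod_one_add_sq (y : Fin n → ℝ) : ∑ i, y i ^ 2 ≤ ∏ i, (1 + y i ^ 2) := by
  have h : ∀ s : Finset (Fin n), 1 + ∑ i ∈ s, y i ^ 2 ≤ ∏ i ∈ s, (1 + y i ^ 2) := by
    intro s
    induction s using Finset.cons_induction with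
    | empty => simp
    | cons a s ha ih =>
      rw [Finset.sum_cons, Finset.prod_cons]
      have h0 : 0 ≤ ∑ i ∈ s, y i ^ 2 := Finset.sum_nonneg fun i _ => sq_nonneg _
      nlinarith [sq_nonneg (y a), mul_nonneg (sq_nonneg (y a)) h0]
  linarith [h Finset.univ]

/-- The part of a discrete moment carried by nodes at distance at least `ρ` is `O(ρ⁻²)`: it is
dominated by `ρ⁻²` times a moment of higher order. -/
theorem eventually_abs_tail_le (α : Fin n → ℕ) :
    ∀ᶠ D : ℝ in atTop, ∀ (s : Fin n → ℝ) (J : Set (Fin n → ℤ)) (ρ : ℝ), 0 < ρ →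
      (∀ m ∈ J, ρ ^ 2 ≤ ∑ i, node D (s i) (m i) ^ 2) →
      |∑' m : J, ∏ i, node D (s i) (m.1 i) ^ α i * weight D (s i) (m.1 i)| ≤
        (ρ ^ 2)⁻¹ * ∏ i, (momentBound (α i) + momentBound (α i + 2)) := by
  filter_upwards [eventually_all.2 fun i => eventually_absMoment_le (α i),
    eventually_all.2 fun i => eventually_absMoment_le (α i + 2),
    eventually_gt_atTop (0 : ℝ)] with D hD hD2 hD0 s J ρ hρ hJ
  have hs : ∀ i, Summable fun k : ℤ => |node D (s i) k| ^ α i * weight D (s i) k +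
      |node D (s i) k| ^ (α i + 2) * weight D (s i) k := fun i =>
    (summable_abs_node_pow_mul_weight _ hD0 _).add (summable_abs_node_pow_mul_weight _ hD0 _)
  have hsum := hasSum_fin_prod _ hs
  set G : (Fin n → ℤ) → ℝ := fun m => ∏ i, (|node D (s i) (m i)| ^ α i * weight D (s i) (m i) +
      |node D (s i) (m i)| ^ (α i + 2) * weight D (s i) (m i)) with hG
  have hG0 : ∀ m, 0 ≤ G m := fun m => Finset.prod_nonneg fun i _ =>
    add_nonneg (mul_nonneg (by positivity) (weight_nonneg _ _ _))
      (mul_nonneg (by positivity) (weight_nonneg _ _ _))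
  have hle : ∀ m : J, ‖∏ i, node D (s i) (m.1 i) ^ α i * weight D (s i) (m.1 i)‖ ≤
      (ρ ^ 2)⁻¹ * G m := by
    intro m
    rw [le_inv_mul_iff₀ (by positivity), norm_prod]
    have h1 : G m = (∏ i, (1 + node D (s i) (m.1 i) ^ 2)) *
        ∏ i, ‖node D (s i) (m.1 i) ^ α i * weight D (s i) (m.1 i)‖ := by
      rw [hG, ← Finset.prod_mul_distrib]
      refine Finset.prod_congr rfl fun i _ => ?_
      rw [norm_mul, norm_pow, Real.norm_eq_abs, Real.norm_of_nonneg (weight_nonneg _ _ _),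
        ← sq_abs (node D (s i) (m.1 i))]
      ring
    rw [h1]
    exact mul_le_mul_of_nonneg_right ((hJ m m.2).trans (sum_sq_le_prod_one_add_sq _))
      (Finset.prod_nonneg fun i _ => norm_nonneg _)
  refine (tsum_of_norm_bounded ((hsum.summable.subtype J).mul_left _).hasSum hle).trans ?_
  rw [tsum_mul_left]
  gcongr
  calc ∑' m : J, G m ≤ ∑' m, G m := hsum.summable.tsum_subtype_le G J hG0
    _ = ∏ i, ∑' k : ℤ, (|node D (s i) k| ^ α i * weight D (s i) k +
      |node D (s i) k| ^ (α i + 2) * weight D (s i) k) := hsum.tsum_eq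
    _ ≤ _ := by
      refine Finset.prod_le_prod (fun i _ => tsum_nonneg fun k => ?_) fun i _ => ?_
      · exact add_nonneg (mul_nonneg (by positivity) (weight_nonneg _ _ _))
          (mul_nonneg (by positivity) (weight_nonneg _ _ _))
      · rw [(summable_abs_node_pow_mul_weight _ hD0 _).tsum_add
          (summable_abs_node_pow_mul_weight _ hD0 _)]
        exact add_le_add (hD i _) (hD2 i _)

theorem gridPt_sub_eq {D h : ℝ} (hD : 0 < D) (hh : 0 < h) (x : EuclideanSpace ℝ (Fin n))
    (m : Fin n → ℤ) (i : Fin n) :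
    gridPt h m i - x i = h * √D * node D (x i / h) (m i) := by
  have := (Real.sqrt_pos.2 hD).ne'
  simp only [gridPt, node]
  field_simp

theorem norm_sub_gridPt_sq {D h : ℝ} (hD : 0 < D) (hh : 0 < h) (x : EuclideanSpace ℝ (Fin n))
    (m : Fin n → ℤ) :
    ‖x - gridPt h m‖ ^ 2 = h ^ 2 * D * ∑ i, node D (x i / h) (m i) ^ 2 := by
  rw [norm_sub_rev, EuclideanSpace.norm_sq_eq, Finset.mul_sum]
  refine Finset.sum_congr rfl fun i _ => ?_
  rw [PiLp.sub_apply, gridPt_sub_eq hD hh, Real.norm_eq_abs, sq_abs, mul_pow, mul_pow,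
    Real.sq_sqrt hD.le]

/-- The Gaussian weight with its normalization is a product of one-dimensional weights. -/
theorem const_mul_qiTerm {D h : ℝ} (hD : 0 < D) (hh : 0 < h) (u : EuclideanSpace ℝ (Fin n) → ℝ)
    (x : EuclideanSpace ℝ (Fin n)) (m : Fin n → ℤ) :
    (Real.pi * D) ^ (-(n : ℝ) / 2) * qiTerm u D h x m =
      u (gridPt h m) * ∏ i, weight D (x i / h) (m i) := by
  have hpi : 0 < Real.pi * D := mul_pos Real.pi_pos hD
  have h1 : (Real.pi * D) ^ (-(n : ℝ) / 2) = (√(Real.pi * D))⁻¹ ^ n := by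
    rw [Real.sqrt_eq_rpow, ← Real.rpow_neg hpi.le, ← Real.rpow_natCast, ← Real.rpow_mul hpi.le]
    congr 1
    ring
  have h2 : -‖x - gridPt h m‖ ^ 2 / (h ^ 2 * D) = ∑ i, -node D (x i / h) (m i) ^ 2 := by
    rw [norm_sub_gridPt_sq hD hh, Finset.sum_neg_distrib]
    field_simp
  simp only [weight, Finset.prod_mul_distrib, Finset.prod_const, Finset.card_univ,
    Fintype.card_fin, qiTerm]
  rw [h1, h2, Real.exp_sum]
  ring

/-- A continuous function on an open set is bounded everywhere by its essential supremum. -/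
theorem abs_le_toReal_eLpNorm_top {E : Type*} [TopologicalSpace E] [MeasurableSpace E]
    [OpensMeasurableSpace E] {μ : Measure E} [μ.IsOpenPosMeasure] {U : Set E} (hU : IsOpen U)
    {f : E → ℝ} (hf : ContinuousOn f U) (hfin : eLpNorm f ∞ (μ.restrict U) ≠ ∞) {z : E}
    (hz : z ∈ U) : |f z| ≤ (eLpNorm f ∞ (μ.restrict U)).toReal := by
  by_contra! hlt
  set B := (eLpNorm f ∞ (μ.restrict U)).toReal with hB
  have hopen : IsOpen (U ∩ (fun y => |f y|) ⁻¹' Ioi B) := hf.abs.isOpen_inter_preimage hU isOpen_Ioi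
  have hae : ∀ᵐ y ∂μ, y ∈ U → |f y| ≤ B := by
    rw [← ae_restrict_iff' hU.measurableSet]
    filter_upwards [ae_le_eLpNormEssSup (f := f) (μ := μ.restrict U)] with y hy
    rw [← eLpNorm_exponent_top] at hy
    have := ENNReal.toReal_mono hfin hy
    simpa [hB] using this
  have hnull : μ (U ∩ (fun y => |f y|) ⁻¹' Ioi B) = 0 := by
    refine measure_mono_null (fun y hy => ?_) hae
    simp only [mem_inter_iff, mem_preimage, mem_Ioi] at hy
    simpa using hy
  have := hopen.eq_empty_of_measure_zero hnull
  exact (this ▸ (⟨hz, hlt⟩ : z ∈ U ∩ (fun y => |f y|) ⁻¹' Ioi B) : z ∈ (∅ : Set E))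

theorem eLpNorm_mderiv_ne_top {N : ℕ} {Ω : Set (EuclideanSpace ℝ (Fin n))}
    {u : EuclideanSpace ℝ (Fin n) → ℝ} (hc : cConst N Ω u < ∞) {β : Fin n → ℕ}
    (hβ : β ∈ multiIdx n N) : eLpNorm (mderiv β u) ∞ (volume.restrict Ω) ≠ ∞ := by
  have h := (ENNReal.sum_lt_top.1 hc) β hβ
  refine (ENNReal.lt_top_of_mul_ne_top_left h.ne ?_).ne
  exact (ENNReal.ofReal_pos.2 (Finset.prod_pos fun j _ => by positivity)).ne'

theorem toReal_cConst {N : ℕ} {Ω : Set (EuclideanSpace ℝ (Fin n))}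
    {u : EuclideanSpace ℝ (Fin n) → ℝ} (hc : cConst N Ω u < ∞) :
    (cConst N Ω u).toReal = ∑ β ∈ multiIdx n N,
      (eLpNorm (mderiv β u) ∞ (volume.restrict Ω)).toReal *
        ∏ j with 0 < β j, √(2 / ((β j - 1)! : ℝ)) := by
  rw [cConst, ENNReal.toReal_sum fun β hβ => ((ENNReal.sum_lt_top.1 hc) β hβ).ne]
  refine Finset.sum_congr rfl fun β _ => ?_
  rw [ENNReal.toReal_mul, ENNReal.toReal_ofReal (Finset.prod_nonneg fun j _ => by positivity)]

theorem prod_momentBound_le (β : Fin n → ℕ) :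
    ∏ i, momentBound (β i) ≤ 2 ^ n * (∏ i, ((β i)! : ℝ)) *
      ∏ j with 0 < β j, √(2 / ((β j - 1)! : ℝ)) := by
  have h : ∀ i, momentBound (β i) ≤
      2 * (β i)! * if 0 < β i then √(2 / ((β i - 1)! : ℝ)) else 1 := by
    intro i
    unfold momentBound
    split_ifs with hi
    · gcongr
      have : (0 : ℝ) ≤ (β i)! := by positivity
      linarith
    · simp [Nat.eq_zero_of_not_pos hi]
  calc ∏ i, momentBound (β i) ≤ ∏ i, 2 * ((β i)! : ℝ) *
        (if 0 < β i then √(2 / ((β i - 1)! : ℝ)) else 1) :=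
        Finset.prod_le_prod (fun i _ => momentBound_nonneg _) fun i _ => h i
    _ = _ := by
      rw [Finset.prod_mul_distrib, Finset.prod_mul_distrib, Finset.prod_ite, Finset.prod_const_one,
        mul_one]
      simp

/-- A ball about a point of `Ω` that does not reach the frontier is connected, hence lies in `Ω`. -/
theorem ball_subset_of_forall_frontier {E : Type*} [NormedAddCommGroup E] [NormedSpace ℝ E]
    {Ω : Set E} (hΩ : IsOpen Ω) {x : E} (hx : x ∈ Ω) {δ : ℝ} (hδ0 : 0 < δ)
    (hδ : ∀ y ∈ frontier Ω, δ ≤ dist x y) : Metric.ball x δ ⊆ Ω := by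
  refine (convex_ball x δ).isPreconnected.subset_left_of_subset_union hΩ
    (isClosed_closure (s := Ω)).isOpen_compl
    (disjoint_compl_right.mono_left subset_closure |>.mono_right le_rfl) (fun y hy => ?_)
    ⟨x, Metric.mem_ball_self hδ0, hx⟩
  by_contra hy'
  simp only [mem_union, mem_compl_iff, not_or, not_not] at hy'
  have : y ∈ frontier Ω := by
    rw [hΩ.frontier_eq]
    exact ⟨hy'.2, hy'.1⟩
  rw [Metric.mem_ball'] at hy
  exact absurd (hδ y this) (not_le.2 hy)

end Lattice

/-! ### The error estimate -/

section Estimate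

open Filter Topology Set
open scoped ContDiff

variable {n : ℕ}

theorem multiIdx_zero : multiIdx n 0 = {0} := Finset.piAntidiag_zero _

theorem mderiv_zero (u : EuclideanSpace ℝ (Fin n) → ℝ) : mderiv 0 u = u := by
  have h : ∀ l : List (Fin n),
      l.foldr (fun i g => (pderiv i)^[(0 : Fin n → ℕ) i] g) u = u := by
    intro l
    induction l with
    | nil => rfl
    | cons i l ih => simp
  exact h _

theorem one_le_prod_factorial (α : Fin n → ℕ) : 1 ≤ ∏ i, ((α i)! : ℝ) :=
  Finset.one_le_prod fun _ _ => Nat.one_le_cast.2 (Nat.factorial_pos _)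

/-- A smooth function killed by the Laplacian is reproduced by its Taylor polynomial with monomials
replaced by their Gaussian moments. -/
theorem sum_taylor_gaussMoment {Ω : TopologicalSpace.Opens (EuclideanSpace ℝ (Fin n))}
    {u : EuclideanSpace ℝ (Fin n) → ℝ} (hu : ContDiffOn ℝ ∞ u Ω)
    (hΔ : ∀ x ∈ Ω, Laplacian.laplacian u x = 0) {N : ℕ} (hN : 0 < N) (H : ℝ)
    {x : EuclideanSpace ℝ (Fin n)} (hx : x ∈ Ω) :
    ∑ k ∈ Finset.range N, ∑ α ∈ multiIdx n k,
      mderiv α u x / (∏ i, ((α i)! : ℝ)) * H ^ k * ∏ i, gaussMoment (α i) = u x := by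
  rw [Finset.sum_eq_single_of_mem 0 (Finset.mem_range.2 hN)]
  · simp [multiIdx_zero, mderiv_zero, gaussMoment_zero]
  · intro k _ hk
    have h := sum_moment_mderiv_eq_zero (c := fun k => gaussMoment k / k !) (a := 1 / 4) hu hΔ
      (fun j => by simp [gaussMoment_odd]) gaussMoment_even_div_factorial hk hx
    rw [← mul_zero (H ^ k), ← h, Finset.mul_sum]
    refine Finset.sum_congr rfl fun α _ => ?_
    rw [Finset.prod_div_distrib]
    ring

theorem prod_scaled_pow {k : ℕ} {α : Fin n → ℕ} (hα : α ∈ multiIdx n k) (H : ℝ) (y : Fin n → ℝ) :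
    ∏ i, (H * y i) ^ α i = H ^ k * ∏ i, y i ^ α i := by
  simp only [mul_pow, Finset.prod_mul_distrib, Finset.prod_pow_eq_pow_sum]
  rw [(Finset.mem_piAntidiag.1 hα).1]

/-- The error estimate, given the estimates `hmom` and `habs` for the discrete moments over the
nodes in `Ω`. -/
theorem abs_sub_quasiInterp_le {Ω : TopologicalSpace.Opens (EuclideanSpace ℝ (Fin n))}
    (hconv : Convex ℝ (Ω : Set (EuclideanSpace ℝ (Fin n)))) {u : EuclideanSpace ℝ (Fin n) → ℝ}
    (hu : ContDiffOn ℝ ∞ u Ω) (hΔ : ∀ x ∈ Ω, Laplacian.laplacian u x = 0) {N : ℕ} (hN : 0 < N)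
    (hc : cConst N Ω u < ⊤) {D h ε : ℝ} (hD : 0 < D) (hh : 0 < h)
    {x : EuclideanSpace ℝ (Fin n)} (hx : x ∈ Ω)
    (hmom : ∀ k ∈ Finset.range N, ∀ α ∈ multiIdx n k,
      |∑' m : {m : Fin n → ℤ // gridPt h m ∈ (Ω : Set (EuclideanSpace ℝ (Fin n)))},
        ∏ i, node D (x i / h) (m.1 i) ^ α i * weight D (x i / h) (m.1 i) -
        ∏ i, gaussMoment (α i)| ≤ ε)
    (habs : ∀ β ∈ multiIdx n N, ∑' m : Fin n → ℤ,
      ∏ i, |node D (x i / h) (m i)| ^ β i * weight D (x i / h) (m i) ≤ ∏ i, momentBound (β i)) :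
    Summable (fun m : {m : Fin n → ℤ // gridPt h m ∈ (Ω : Set (EuclideanSpace ℝ (Fin n)))} =>
      qiTerm u D h x m) ∧
    |u x - quasiInterp Ω u D h x| ≤ 2 ^ n * (h * √D) ^ N * (cConst N Ω u).toReal +
      ε * ∑ k ∈ Finset.range N, ∑ β ∈ multiIdx n k, (h * √D) ^ k * |mderiv β u x| := by
  set I := {m : Fin n → ℤ // gridPt h m ∈ (Ω : Set (EuclideanSpace ℝ (Fin n)))}
  set H := h * √D with hH
  have hH0 : 0 ≤ H := by positivity
  set s : Fin n → ℝ := fun i => x i / h with hs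
  set y : I → Fin n → ℝ := fun m i => node D (s i) (m.1 i) with hy
  set w : I → ℝ := fun m => ∏ i, weight D (s i) (m.1 i) with hw
  have hw0 : ∀ m, 0 ≤ w m := fun m => Finset.prod_nonneg fun i _ => weight_nonneg _ _ _
  set B : (Fin n → ℕ) → ℝ := fun β =>
    (eLpNorm (mderiv β u) ⊤ (volume.restrict (Ω : Set (EuclideanSpace ℝ (Fin n))))).toReal with hB
  have hB0 : ∀ β, 0 ≤ B β := fun β => ENNReal.toReal_nonneg
  set a : (Fin n → ℕ) → ℝ := fun α => mderiv α u x / (∏ i, ((α i)! : ℝ)) with ha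
  -- The Taylor polynomial at the nodes, and the majorant of the remainder.
  set T : I → ℝ := fun m => ∑ k ∈ Finset.range N, ∑ α ∈ multiIdx n k,
    a α * H ^ k * ((∏ i, y m i ^ α i) * w m) with hT
  set R : I → ℝ := fun m => ∑ β ∈ multiIdx n N,
    B β / (∏ i, ((β i)! : ℝ)) * H ^ N * ((∏ i, |y m i| ^ β i) * w m) with hR
  have hgrid : ∀ (m : I) (i : Fin n), gridPt h m.1 i - x i = H * y m i := fun m i =>
    gridPt_sub_eq hD hh x m.1 i
  have htaylor : ∀ m : I, ‖u (gridPt h m.1) * w m - T m‖ ≤ R m := by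
    intro m
    have key := abs_sub_multivariate_taylor_le (N := N) (B := B) hconv hu
      (fun β hβ z hz => abs_le_toReal_eLpNorm_top Ω.2 (continuousOn_mderiv hu β)
        (eLpNorm_mderiv_ne_top hc hβ) hz) hx m.2
    simp only [hgrid, abs_mul, abs_of_nonneg hH0] at key
    have h1 : T m = (∑ k ∈ Finset.range N, ∑ α ∈ multiIdx n k,
        a α * ∏ i, (H * y m i) ^ α i) * w m := by
      simp only [hT, Finset.sum_mul]
      refine Finset.sum_congr rfl fun k _ => Finset.sum_congr rfl fun α hα => ?_
      rw [prod_scaled_pow hα]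
      ring
    have h2 : R m = (∑ β ∈ multiIdx n N, B β / (∏ i, ((β i)! : ℝ)) *
        ∏ i, (H * |y m i|) ^ β i) * w m := by
      simp only [hR, Finset.sum_mul]
      refine Finset.sum_congr rfl fun β hβ => ?_
      rw [prod_scaled_pow hβ H fun i => |y m i|]
      ring
    rw [h1, h2, ← sub_mul, norm_mul, Real.norm_of_nonneg (hw0 m)]
    exact mul_le_mul_of_nonneg_right key (hw0 m)
  have hsumA : ∀ α : Fin n → ℕ, Summable fun m : I => (∏ i, y m i ^ α i) * w m := fun α => by
    have := (hasSum_multi_node α hD s).summable.comp_injective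
      (Subtype.val_injective : Function.Injective (Subtype.val : I → Fin n → ℤ))
    simpa only [Function.comp_def, Finset.prod_mul_distrib] using this
  have hsumA' : ∀ α : Fin n → ℕ, Summable fun m : Fin n → ℤ =>
      (∏ i, |node D (s i) (m i)| ^ α i) * ∏ i, weight D (s i) (m i) := fun α => by
    simpa only [Finset.prod_mul_distrib] using (hasSum_multi_abs_node α hD s).summable
  have hsumR' : ∀ α : Fin n → ℕ, Summable fun m : I => (∏ i, |y m i| ^ α i) * w m := fun α =>
    (hsumA' α).comp_injective
      (Subtype.val_injective : Function.Injective (Subtype.val : I → Fin n → ℤ))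
  have hsumT : Summable T := summable_sum fun k _ => summable_sum fun α _ => (hsumA α).mul_left _
  have hsumR : Summable R := summable_sum fun β _ => (hsumR' β).mul_left _
  have hsumd : Summable fun m : I => u (gridPt h m.1) * w m - T m :=
    Summable.of_norm_bounded hsumR htaylor
  have hsumu : Summable fun m : I => u (gridPt h m.1) * w m := by simpa using hsumd.add hsumT
  have hpi : 0 < Real.pi * D := mul_pos Real.pi_pos hD
  have hqi : ∀ m : I, (Real.pi * D) ^ (-(n : ℝ) / 2) * qiTerm u D h x m =
      u (gridPt h m.1) * w m := fun m => const_mul_qiTerm hD hh u x m.1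
  refine ⟨?_, ?_⟩
  · rw [← summable_mul_left_iff (Real.rpow_pos_of_pos hpi (-(n : ℝ) / 2)).ne']
    simpa only [hqi] using hsumu
  have hM : quasiInterp Ω u D h x = ∑' m : I, T m + ∑' m : I, (u (gridPt h m.1) * w m - T m) := by
    rw [← hsumT.tsum_add hsumd, quasiInterp, ← tsum_mul_left]
    exact tsum_congr fun m => by rw [hqi]; ring
  have hTsum : ∑' m : I, T m = ∑ k ∈ Finset.range N, ∑ α ∈ multiIdx n k,
      a α * H ^ k * ∑' m : I, (∏ i, y m i ^ α i) * w m := by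
    simp only [hT]
    rw [Summable.tsum_finsetSum fun k _ => summable_sum fun α _ => (hsumA α).mul_left _]
    refine Finset.sum_congr rfl fun k _ => ?_
    rw [Summable.tsum_finsetSum fun α _ => (hsumA α).mul_left _]
    exact Finset.sum_congr rfl fun α _ => tsum_mul_left
  have h1 : |u x - ∑' m : I, T m| ≤
      ε * ∑ k ∈ Finset.range N, ∑ β ∈ multiIdx n k, H ^ k * |mderiv β u x| := by
    rw [← sum_taylor_gaussMoment hu hΔ hN H hx, hTsum, ← Finset.sum_sub_distrib, Finset.mul_sum]
    refine (Finset.abs_sum_le_sum_abs _ _).trans (Finset.sum_le_sum fun k hk => ?_)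
    rw [← Finset.sum_sub_distrib, Finset.mul_sum]
    refine (Finset.abs_sum_le_sum_abs _ _).trans (Finset.sum_le_sum fun α hα => ?_)
    have h2 := hmom k hk α hα
    simp only [Finset.prod_mul_distrib] at h2
    rw [← mul_sub, abs_mul, abs_mul, abs_of_nonneg (pow_nonneg hH0 k), abs_sub_comm]
    have h3 : |a α| ≤ |mderiv α u x| := by
      rw [ha, abs_div, abs_of_pos (zero_lt_one.trans_le (one_le_prod_factorial α))]
      exact div_le_self (abs_nonneg _) (one_le_prod_factorial α)
    calc |a α| * H ^ k * _ ≤ |mderiv α u x| * H ^ k * ε := by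
          gcongr
      _ = ε * (H ^ k * |mderiv α u x|) := by ring
  have h2 : |∑' m : I, (u (gridPt h m.1) * w m - T m)| ≤
      2 ^ n * H ^ N * (cConst N Ω u).toReal := by
    refine (tsum_of_norm_bounded hsumR.hasSum htaylor).trans ?_
    simp only [hR]
    rw [Summable.tsum_finsetSum fun β _ => (hsumR' β).mul_left _, toReal_cConst hc, Finset.mul_sum]
    refine Finset.sum_le_sum fun β hβ => ?_
    rw [tsum_mul_left]
    have hF := zero_lt_one.trans_le (one_le_prod_factorial β)
    have h3 : ∑' m : I, (∏ i, |y m i| ^ β i) * w m ≤ ∏ i, momentBound (β i) := by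
      refine le_trans ?_ (habs β hβ)
      simp only [Finset.prod_mul_distrib]
      exact (hsumA' β).tsum_subtype_le _ {m | gridPt h m ∈ (Ω : Set (EuclideanSpace ℝ (Fin n)))}
        fun m => mul_nonneg (Finset.prod_nonneg fun i _ => by positivity)
          (Finset.prod_nonneg fun i _ => weight_nonneg _ _ _)
    calc B β / (∏ i, ((β i)! : ℝ)) * H ^ N * ∑' m : I, (∏ i, |y m i| ^ β i) * w m
        ≤ B β / (∏ i, ((β i)! : ℝ)) * H ^ N * (2 ^ n * (∏ i, ((β i)! : ℝ)) *
          ∏ j with 0 < β j, √(2 / ((β j - 1)! : ℝ))) := by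
          have := hB0 β
          gcongr
          exact h3.trans (prod_momentBound_le β)
      _ = _ := by
          field_simp
          exact mul_comm _ _
  rw [hM, ← sub_sub]
  refine (abs_sub _ _).trans ?_
  rw [add_comm]
  exact add_le_add h2 h1

end Estimate

end HarmonicQI

end

theorem theorem5p2 (n : ℕ) :
    ∃ C : ℝ, 0 < C ∧
      ∀ (M : ℕ), 1 ≤ M →
      ∀ (Ω : Set (EuclideanSpace ℝ (Fin n))), IsOpen Ω → Convex ℝ Ω →
      ∀ (u : EuclideanSpace ℝ (Fin n) → ℝ), InnerProductSpace.HarmonicOnNhd u Ω →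
        HarmonicQI.cConst (2 * M) Ω u < ∞ →
      ∀ (ε : ℝ), 0 < ε →
      ∀ (Ω' : Set (EuclideanSpace ℝ (Fin n))), Ω' ⊆ Ω →
        (∃ δ : ℝ, 0 < δ ∧ ∀ x ∈ Ω', ∀ y ∈ frontier Ω, δ ≤ dist x y) →
      ∃ D : ℝ, 0 < D ∧ ∃ h₀ : ℝ, 0 < h₀ ∧ ∀ h : ℝ, 0 < h → h ≤ h₀ → ∀ x ∈ Ω',
        Summable (fun m : {m : Fin n → ℤ // HarmonicQI.gridPt h m ∈ Ω} =>
          HarmonicQI.qiTerm u D h x m) ∧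
        |u x - HarmonicQI.quasiInterp Ω u D h x| ≤
          C * (h * √D) ^ (2 * M) * (HarmonicQI.cConst (2 * M) Ω u).toReal +
            ε * ∑ k ∈ Finset.range (2 * M), ∑ β ∈ HarmonicQI.multiIdx n k,
              (h * √D) ^ k * |HarmonicQI.mderiv β u x| := by
  open HarmonicQI in
  refine ⟨2 ^ n, by positivity, ?_⟩
  intro M hM Ω hΩ hconv u hu hc ε hε Ω' hΩ' ⟨δ, hδ, hdist⟩
  set N := 2 * M
  have hsmooth := contDiffOn_of_harmonicOnNhd hΩ hu
  -- `D` makes the moments over the whole lattice accurate.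
  obtain ⟨D, hD, hmom, habs, htail⟩ := ((Filter.eventually_gt_atTop (0 : ℝ)).and
    (((Finset.eventually_all (Finset.range N)).2 fun k _ =>
      (Finset.eventually_all (multiIdx n k)).2 fun α _ =>
        eventually_multi_moment α (half_pos hε)).and
    (((Finset.eventually_all (multiIdx n N)).2 fun β _ => eventually_multi_absMoment_le β).and
    ((Finset.eventually_all (Finset.range N)).2 fun k _ =>
      (Finset.eventually_all (multiIdx n k)).2 fun α _ => eventually_abs_tail_le α)))).exists
  have hDs : 0 < √D := Real.sqrt_pos.2 hD
  -- `h₀` makes the contribution of the nodes outside `Ω` small.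
  obtain ⟨h₀, hh₀, htail0⟩ : ∃ h₀ : ℝ, 0 < h₀ ∧ ∀ h, 0 < h → h ≤ h₀ →
      ∀ k ∈ Finset.range N, ∀ α ∈ multiIdx n k,
        ((δ / (h * √D)) ^ 2)⁻¹ * ∏ i, (momentBound (α i) + momentBound (α i + 2)) ≤ ε / 2 := by
    have hev : ∀ᶠ h in nhds (0 : ℝ), ∀ k ∈ Finset.range N, ∀ α ∈ multiIdx n k,
        ((δ / (h * √D)) ^ 2)⁻¹ * ∏ i, (momentBound (α i) + momentBound (α i + 2)) ≤ ε / 2 := by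
      refine (Finset.eventually_all _).2 fun k _ => (Finset.eventually_all _).2 fun α _ => ?_
      have hcont : Continuous fun h : ℝ => ((δ / (h * √D)) ^ 2)⁻¹ *
          ∏ i, (momentBound (α i) + momentBound (α i + 2)) := by
        simp only [← inv_pow, inv_div]
        fun_prop
      exact (hcont.tendsto 0).eventually_le_const (by simpa using half_pos hε)
    obtain ⟨r, hr, hball⟩ := Metric.eventually_nhds_iff_ball.1 hev
    refine ⟨r / 2, half_pos hr, fun h h0 hle => hball h ?_⟩
    rw [Metric.mem_ball, dist_zero_right, Real.norm_of_nonneg h0.le]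
    linarith
  refine ⟨D, hD, h₀, hh₀, fun h hh hle x hx => ?_⟩
  refine abs_sub_quasiInterp_le (Ω := ⟨Ω, hΩ⟩) hconv hsmooth
    (fun z hz => (hu z hz).2.eq_of_nhds) (by lia) hc hD hh (hΩ' hx) (fun k hk α hα => ?_)
    fun β hβ => habs β hβ _
  have hsum := (hasSum_multi_node α hD fun i => x i / h).summable
  have hsplit := hsum.tsum_subtype_add_tsum_subtype_compl {m | gridPt h m ∈ Ω}
  have h1 := hmom k hk α hα fun i => x i / h
  have h2 := (htail k hk α hα (fun i => x i / h) {m | gridPt h m ∈ Ω}ᶜ (δ / (h * √D))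
    (by positivity) (fun m hm => by
      have hball := ball_subset_of_forall_frontier hΩ (hΩ' hx) hδ (hdist x hx)
      have hnorm : δ ≤ ‖x - gridPt h m‖ := by
        rw [← dist_eq_norm]
        by_contra! hlt
        exact hm (hball (Metric.mem_ball'.2 hlt))
      have hsq := pow_le_pow_left₀ hδ.le hnorm 2
      rw [norm_sub_gridPt_sq hD hh] at hsq
      rw [div_pow, mul_pow, Real.sq_sqrt hD.le, div_le_iff₀' (by positivity)]
      exact hsq)).trans (htail0 h hh hle k hk α hα)
  rw [← hsplit] at h1
  rw [abs_le] at h1 h2 ⊢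
  constructor
  · exact (by linarith [h1.1, h2.2] : -ε ≤ ∑' m : {m : Fin n → ℤ | gridPt h m ∈ Ω}, _ - _)
  · exact (by linarith [h1.2, h2.1] : ∑' m : {m : Fin n → ℤ | gridPt h m ∈ Ω}, _ - _ ≤ ε)
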